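/- Let $K$ be a totally real number field of degree $g$, with real embeddings $x\mapsto x^{(i)}$ ($1\le i\le g$), and write $\mathbf 1=(1,\dots,1)$, $\mathrm{Tr}=\mathrm{Tr}_{K/\mathbb Q}$. A lattice in $K$ is a free $\mathbb Z$-submodule $L$ of rank $g$; put $L^*=\{x\in K:\mathrm{Tr}(xL)\subseteq\mathbb Z\}$ and $\mathcal O_L=\{x\in K: xL\subseteq L\}$. For $a,b\in K$ let $\mathcal V_{a,b,L}$ be the group of $\epsilon\in\mathcal O_L^\times$ with $(\epsilon-1)a\in L$, $(\epsilon-1)b\in L^*$, $(\epsilon-1)ab\in(\mathcal O_L)^*$. Let $\mathfrak m,\mathfrak n\subset K$ be lattices, $U=\begin{pmatrix}u_1&v_1\\u_2&v_2\end{pmatrix}\in M_2(K)$, $p\in\mathbb Z^g$, $w\in\mathbb Z$, and let $\mathcal V^+_U(\mathfrak m\oplus\mathfrak n)$ be the group of totally positive elements of $\mathcal V_{v_1,u_1,\mathfrak m}\cap\mathcal V_{v_2,u_2,\mathfrak n}$. Let $K_{\mathbb C}^{\pm}=(\mathbb C\setminus\mathbb R)^g$. For $\gamma=(\gamma_i)_i\in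 GL_2(\mathbb R)^g$, $\gamma_i=\begin{pmatrix}a_i&b_i\\c_i&d_i\end{pmatrix}$, and $z\in K_{\mathbb C}^\pm$ let $\gamma z=\big(\tfrac{a_iz_i+b_i}{c_iz_i+d_i}\big)_i$, $j(\gamma,z)=(c_iz_i+d_i)_i$; regard $GL_2(K)\subset GL_2(\mathbb R)^g$ through the embeddings. For $\alpha,\beta\in\mathbb C^g$ with $\alpha-\beta\in\mathbb Z^g$ and $z\in(\mathbb C^\times)^g$ let $P(\alpha,\beta;z)=\prod_i z_i^{\alpha_i}\overline{z_i}^{\,\beta_i}$, with principal powers, a negative real $z_i$ being approached from the upper half plane; $j(\gamma,z)^{-\alpha}j(\gamma,\bar z)^{-\beta}$ means $P(-\alpha,-\beta;j(\gamma,z))$. For a tuple $x$ write $|x|^\mu=\prod_i|x_i|^{\mu_i}$. For $F:K_{\mathbb C}^\pm\to\mathbb C$ and $\mu\in\mathbb C^g$ set $$F\big|_{\{[\alpha,\beta];\mu\},\gamma}(z)=j(\gamma,z)^{-\alpha}j(\gamma,\bar z)^{-\beta}|\det\gamma|^{-\mu}F(\gamma z).$$ $F$ is of bi-weight $\{[\alpha,\beta];\mu\}$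 relative to a group $\Gamma$ if $F|_{\{[\alpha,\beta];\mu\},\gamma}=F$ for all $\gamma\in\Gamma$, and almost of that bi-weight if $F|_{\{[\alpha,\beta];\mu\},\gamma}(z)=\zeta_{\gamma,z}F(z)$ for roots of unity $\zeta_{\gamma,z}$ depending only on $\gamma$ and on the connected component of $z$ in $K_{\mathbb C}^\pm$. Put $\alpha(s)=(s+w)\mathbf 1-\frac p2$, $\beta(s)=s\mathbf 1+\frac p2$. For $\mathrm{Re}(s)>1-\frac w2$ and $z=x+iy\in K_{\mathbb C}^\pm$ let $$G_{(\mathfrak m,\mathfrak n)}^{\alpha(s),\beta(s)}(U;z)=\sum_{(a,b)}\frac{e^{2\pi i\,\mathrm{Tr}(u_1a+u_2b)}\,|y|^{s\mathbf 1}}{P(\alpha(s),\beta(s);az+b)},$$ where $(a,b)$ runs through representatives of $\big((\mathfrak m+v_1)\times(\mathfrak n+v_2)\big)\setminus\{(0,0)\}$ modulo the diagonal action of $\mathcal V_U^+(\mathfrak m\oplus\mathfrak n)$; for other $s$ the symbol denotes the value of the meromorphic continuation in $s$ (the identities below are then identities away from poles). For $\gamma\in GL_2(K)$ let $U^\gamma=\Big(\gamma^{-1}\binom{u_1}{u_2},\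 \gamma^t\binom{v_1}{v_2}\Big)$, let $GL_2(K)$ act on row vectors in $K^2$ by right multiplication, and put $$\Gamma_U(\mathfrak m,\mathfrak n)=\Big\{\gamma\in GL_2(K):(\mathfrak m\oplus\mathfrak n)\gamma=\mathfrak m\oplus\mathfrak n,\ U^\gamma-U\in\begin{pmatrix}\mathfrak m^*&\mathfrak m\\\mathfrak n^*&\mathfrak n\end{pmatrix}\Big\},$$ $$\Gamma_U(\mathfrak m,\mathfrak n;N)=\Big\{\gamma\in\Gamma_U(\mathfrak m,\mathfrak n):U^\gamma-U\in N\begin{pmatrix}\mathfrak m^*&\mathfrak m\\\mathfrak n^*&\mathfrak n\end{pmatrix}\Big\}\quad(N\ge1).$$ Then: (A) For $\mathrm{Re}(s)>1-\frac w2$ the series converges absolutely for every $z\in K_{\mathbb C}^\pm$ and is a continuous function of $z$. (B) Let $\gamma\in GL_2(K)$ be such that $(\mathfrak m\oplus\mathfrak n)\gamma=\mathfrak m'\oplus\mathfrak n'$ with lattices $\mathfrak m',\mathfrak n'$ in $K$. Put $\mathcal V=\mathcal V_U^+(\mathfrak m\oplus\mathfrak n)$, $\mathcal V'=\mathcal V_{U^\gamma}^+(\mathfrak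 m'\oplus\mathfrak n')$, $f_1=[\mathcal V:\mathcal V\cap\mathcal V']$, $f_2=[\mathcal V':\mathcal V\cap\mathcal V']$. Both indices are finite, and for all $s\in\mathbb C$, $z\in K_{\mathbb C}^\pm$, $$j(\gamma,z)^{-\alpha(s)}j(\gamma,\bar z)^{-\beta(s)}|j(\gamma,z)|^{2s\mathbf 1}|\det\gamma|^{-s\mathbf 1}\,G^{\alpha(s),\beta(s)}_{(\mathfrak m,\mathfrak n)}(U;\gamma z)=\frac{f_2}{f_1}\,G^{\alpha(s),\beta(s)}_{(\mathfrak m',\mathfrak n')}(U^\gamma;z).$$ (C) Suppose $U\in\frac1N\begin{pmatrix}\mathfrak m^*&\mathfrak m\\\mathfrak n^*&\mathfrak n\end{pmatrix}$ with an integer $N\ge1$, and put $[\alpha_0,\beta_0]=[w\mathbf 1-\frac p2,\frac p2]$. Then $\Gamma_U(\mathfrak m,\mathfrak n)$ and $\Gamma_U(\mathfrak m,\mathfrak n;N)$ are discrete subgroups of $GL_2(\mathbb R)^g$, and for all $\gamma\in\Gamma_U(\mathfrak m,\mathfrak n)$, $s\in\mathbb C$, $z\in K_{\mathbb C}^\pm$,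 $$G^{\alpha(s),\beta(s)}_{(\mathfrak m,\mathfrak n)}\big|_{\{[\alpha_0,\beta_0];s\mathbf 1\},\gamma}(U;z)=\zeta_{U,U^\gamma}\,G^{\alpha(s),\beta(s)}_{(\mathfrak m,\mathfrak n)}(U;z),\qquad \zeta_{U,U^\gamma}=e^{-2\pi i\,\mathrm{Tr}(u_1''v_1+u_2''v_2)},$$ where $\begin{pmatrix}u_1''&v_1''\\u_2''&v_2''\end{pmatrix}=U-U^\gamma$; the number $\zeta_{U,U^\gamma}$ is a root of unity, with $\zeta_{U,U^\gamma}^N=1$. Consequently, for every $s\in\mathbb C$, the function $z\mapsto G^{\alpha(s),\beta(s)}_{(\mathfrak m,\mathfrak n)}(U;z)$ is almost of bi-weight $\{[\alpha_0,\beta_0];s\mathbf 1\}$ relative to $\Gamma_U(\mathfrak m,\mathfrak n)$, and of bi-weight $\{[\alpha_0,\beta_0];s\mathbf 1\}$ relative to $\Gamma_U(\mathfrak m,\mathfrak n;N)$. -/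

import Mathlib

open scoped BigOperators Matrix Topology

set_option linter.unusedSectionVars false

namespace EisGL2

/-! ### Lattices, multiplier rings, unit groups

A lattice of a number field `K` is a `ℤ`-submodule `L` of `K` with `Submodule.IsLattice ℚ L`
(finitely generated and spanning `K` over `ℚ`, i.e. free of rank `[K : ℚ]`). -/

section Lattices

variable {K : Type*} [Field K] [NumberField K]

/-- The dual lattice `{x ∈ K : Tr(xℓ) ∈ ℤ for all ℓ ∈ L}` for the trace pairing. -/
noncomputable def dual (L : Submodule ℤ K) : Submodule ℤ K :=
  (Algebra.traceForm ℚ K).dualSubmodule L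

theorem mem_dual {L : Submodule ℤ K} {x : K} :
    x ∈ dual L ↔ ∀ y ∈ L, ∃ k : ℤ, (k : ℚ) = Algebra.trace ℚ K (x * y) := by
  simp only [dual, LinearMap.BilinForm.mem_dualSubmodule, Submodule.mem_one,
    Algebra.traceForm_apply, algebraMap_int_eq, eq_intCast]

/-- The multiplier ring `{a ∈ K : aL ⊆ L}` (as a `ℤ`-submodule of `K`). -/
noncomputable def mult (L : Submodule ℤ K) : Submodule ℤ K := L / L

theorem mem_mult {L : Submodule ℤ K} {x : K} : x ∈ mult L ↔ ∀ y ∈ L, x * y ∈ L :=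
  Submodule.mem_div_iff_forall_mul_mem

theorem mult_mul {L : Submodule ℤ K} {x y : K} (hx : x ∈ mult L) (hy : y ∈ mult L) :
    x * y ∈ mult L := by
  rw [mem_mult] at *
  intro z hz
  rw [mul_assoc]
  exact hx _ (hy _ hz)

theorem dual_smul {N : Submodule ℤ K} {e x : K} (he : ∀ y ∈ N, e * y ∈ N) (hx : x ∈ dual N) :
    e * x ∈ dual N := by
  rw [mem_dual] at *
  intro y hy
  obtain ⟨k, hk⟩ := hx (e * y) (he y hy)
  exact ⟨k, by rw [hk]; congr 1; ring⟩

/-- An additive subgroup `M` stable under `e₁` contains `(e₁e₂ - 1)c` with `(eᵢ - 1)c`. -/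
theorem sub_one_mul {M : Submodule ℤ K} {e₁ e₂ c : K} (he : ∀ y ∈ M, e₁ * y ∈ M)
    (h₁ : (e₁ - 1) * c ∈ M) (h₂ : (e₂ - 1) * c ∈ M) : (e₁ * e₂ - 1) * c ∈ M := by
  have h := M.add_mem (he _ h₂) h₁
  have e : (e₁ * e₂ - 1) * c = e₁ * ((e₂ - 1) * c) + (e₁ - 1) * c := by ring
  rwa [e]

theorem sub_one_inv {M : Submodule ℤ K} {e : Kˣ} {c : K}
    (he : ∀ y ∈ M, ((e⁻¹ : Kˣ) : K) * y ∈ M) (h : ((e : K) - 1) * c ∈ M) :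
    (((e⁻¹ : Kˣ) : K) - 1) * c ∈ M := by
  have h' := M.neg_mem (he _ h)
  have e' : (((e⁻¹ : Kˣ) : K) - 1) * c = -(((e⁻¹ : Kˣ) : K) * (((e : K) - 1) * c)) := by
    have : ((e⁻¹ : Kˣ) : K) * (e : K) = 1 := e.inv_mul
    linear_combination c * this
  rwa [e']

/-- The group `𝒱_{a,b,L}` of units `ε` of the multiplier ring `𝒪_L` such that
`(ε-1)a ∈ L`, `(ε-1)b ∈ L*` and `(ε-1)ab ∈ (𝒪_L)*`. -/
noncomputable def unitGroup (a b : K) (L : Submodule ℤ K) : Subgroup Kˣ where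
  carrier := {e | ((e : K) ∈ mult L ∧ ((e⁻¹ : Kˣ) : K) ∈ mult L) ∧
    ((e : K) - 1) * a ∈ L ∧ ((e : K) - 1) * b ∈ dual L ∧
    ((e : K) - 1) * (a * b) ∈ dual (mult L)}
  one_mem' := by
    simp [mem_mult]
  mul_mem' := by
    rintro e f ⟨⟨he, he'⟩, h1, h2, h3⟩ ⟨⟨hf, hf'⟩, g1, g2, g3⟩
    refine ⟨⟨by simpa using mult_mul he hf, ?_⟩, ?_, ?_, ?_⟩
    · have := mult_mul hf' he'
      simpa [mul_comm] using this
    · simpa using sub_one_mul (mem_mult.1 he) h1 g1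
    · simpa using sub_one_mul (fun _ h => dual_smul (mem_mult.1 he) h) h2 g2
    · simpa using sub_one_mul (fun _ h => dual_smul (fun _ h' => mult_mul he h') h) h3 g3
  inv_mem' := by
    rintro e ⟨⟨he, he'⟩, h1, h2, h3⟩
    refine ⟨⟨he', by simpa using he⟩, ?_, ?_, ?_⟩
    · exact sub_one_inv (mem_mult.1 he') h1
    · exact sub_one_inv (fun _ h => dual_smul (mem_mult.1 he') h) h2
    · exact sub_one_inv (fun _ h => dual_smul (fun _ h' => mult_mul he' h') h) h3

variable (K) in
/-- The totally positive elements of `Kˣ`. -/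
def totallyPositive : Subgroup Kˣ where
  carrier := {e | ∀ σ : K →+* ℝ, 0 < σ (e : K)}
  one_mem' := by simp
  mul_mem' := by
    intro e f he hf σ
    simpa using mul_pos (he σ) (hf σ)
  inv_mem' := by
    intro e he σ
    simpa using he σ

/-- For `U = (u₁ v₁; u₂ v₂)`, the group `𝒱_U⁺(𝔪 ⊕ 𝔫)` of totally positive elements of
`𝒱_{v₁,u₁,𝔪} ∩ 𝒱_{v₂,u₂,𝔫}`. -/
noncomputable def unitGroupPos (m n : Submodule ℤ K) (U : Matrix (Fin 2) (Fin 2) K) :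
    Subgroup Kˣ :=
  (unitGroup (U 0 1) (U 0 0) m ⊓ unitGroup (U 1 1) (U 1 0) n) ⊓ totallyPositive K

/-! ### The upper right action and the groups `GL(𝔪 ⊕ 𝔫)`, `Γ_U(𝔪,𝔫)`, `Γ_U(𝔪,𝔫;N)` -/

/-- `𝔪 ⊕ 𝔫`, as a lattice of row vectors. -/
def dirSum (m n : Submodule ℤ K) : Submodule ℤ (Fin 2 → K) where
  carrier := {x | x 0 ∈ m ∧ x 1 ∈ n}
  zero_mem' := ⟨m.zero_mem, n.zero_mem⟩
  add_mem' h h' := ⟨m.add_mem h.1 h'.1, n.add_mem h.2 h'.2⟩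
  smul_mem' c _ h := ⟨m.smul_mem c h.1, n.smul_mem c h.2⟩

/-- The image `Λγ` of a lattice of row vectors under right multiplication by `γ`. -/
def rowMul (Λ : Submodule ℤ (Fin 2 → K)) (γ : GL (Fin 2) K) : Submodule ℤ (Fin 2 → K) :=
  Λ.map ((Matrix.vecMulLinear (γ : Matrix (Fin 2) (Fin 2) K)).restrictScalars ℤ)

theorem mem_rowMul {Λ : Submodule ℤ (Fin 2 → K)} {γ : GL (Fin 2) K} {x : Fin 2 → K} :
    x ∈ rowMul Λ γ ↔ ∃ y ∈ Λ, y ᵥ* (γ : Matrix (Fin 2) (Fin 2) K) = x := by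
  simp [rowMul]

theorem rowMul_one (Λ : Submodule ℤ (Fin 2 → K)) : rowMul Λ 1 = Λ := by
  ext x; simp [mem_rowMul]

theorem rowMul_mul (Λ : Submodule ℤ (Fin 2 → K)) (γ δ : GL (Fin 2) K) :
    rowMul Λ (γ * δ) = rowMul (rowMul Λ γ) δ := by
  ext x
  simp only [mem_rowMul, Units.val_mul]
  constructor
  · rintro ⟨y, hy, rfl⟩
    exact ⟨_, ⟨y, hy, rfl⟩, by simp [Matrix.vecMul_vecMul]⟩
  · rintro ⟨_, ⟨y, hy, rfl⟩, rfl⟩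
    exact ⟨y, hy, by simp [Matrix.vecMul_vecMul]⟩

/-- `GL(𝔪 ⊕ 𝔫) = {γ ∈ GL₂(K) : (𝔪 ⊕ 𝔫)γ = 𝔪 ⊕ 𝔫}`. -/
def latticeGL (m n : Submodule ℤ K) : Subgroup (GL (Fin 2) K) where
  carrier := {γ | rowMul (dirSum m n) γ = dirSum m n}
  one_mem' := rowMul_one _
  mul_mem' := by
    intro γ δ hγ hδ
    simp only [Set.mem_ofPred_eq] at *
    rw [rowMul_mul, hγ, hδ]
  inv_mem' := by
    intro γ hγ
    simp only [Set.mem_ofPred_eq] at *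
    conv_lhs => rw [← hγ]
    rw [← rowMul_mul, mul_inv_cancel, rowMul_one]

/-- The upper right action `U^γ = (γ⁻¹ (u₁,u₂)ᵗ , γᵗ (v₁,v₂)ᵗ)`. -/
def upperAct (U : Matrix (Fin 2) (Fin 2) K) (γ : GL (Fin 2) K) : Matrix (Fin 2) (Fin 2) K :=
  Matrix.of fun i j =>
    if j = 0 then (((γ⁻¹ : GL (Fin 2) K) : Matrix (Fin 2) (Fin 2) K) *ᵥ fun k => U k 0) i
    else ((γ : Matrix (Fin 2) (Fin 2) K)ᵀ *ᵥ fun k => U k 1) i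

/-- The matrices with entries in `(𝔪* 𝔪; 𝔫* 𝔫)`. -/
noncomputable def paramLattice (m n : Submodule ℤ K) : Submodule ℤ (Matrix (Fin 2) (Fin 2) K) where
  carrier := {X | (X 0 0 ∈ dual m ∧ X 1 0 ∈ dual n) ∧ (X 0 1 ∈ m ∧ X 1 1 ∈ n)}
  zero_mem' := by simp
  add_mem' h h' := ⟨⟨add_mem h.1.1 h'.1.1, add_mem h.1.2 h'.1.2⟩,
    ⟨add_mem h.2.1 h'.2.1, add_mem h.2.2 h'.2.2⟩⟩
  smul_mem' c _ h := ⟨⟨Submodule.smul_mem _ c h.1.1, Submodule.smul_mem _ c h.1.2⟩,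
    ⟨Submodule.smul_mem _ c h.2.1, Submodule.smul_mem _ c h.2.2⟩⟩

theorem upperAct_one (U : Matrix (Fin 2) (Fin 2) K) : upperAct U 1 = U := by
  ext i j
  fin_cases j <;> simp [upperAct]

theorem upperAct_mul (U : Matrix (Fin 2) (Fin 2) K) (γ δ : GL (Fin 2) K) :
    upperAct U (γ * δ) = upperAct (upperAct U γ) δ := by
  ext i j
  fin_cases j
  · simp only [upperAct, mul_inv_rev, Units.val_mul, Matrix.of_apply, ← Matrix.mulVec_mulVec]
    simp
  · simp only [upperAct, Units.val_mul, Matrix.of_apply, Matrix.transpose_mul,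
      ← Matrix.mulVec_mulVec]
    simp

theorem upperAct_sub (U V : Matrix (Fin 2) (Fin 2) K) (γ : GL (Fin 2) K) :
    upperAct (U - V) γ = upperAct U γ - upperAct V γ := by
  ext i j
  fin_cases j <;> simp [upperAct, Matrix.mulVec, dotProduct, Fin.sum_univ_two] <;> ring

theorem upperAct_smul (c : ℕ) (U : Matrix (Fin 2) (Fin 2) K) (γ : GL (Fin 2) K) :
    upperAct (c • U) γ = c • upperAct U γ := by
  ext i j
  fin_cases j <;> simp [upperAct, Matrix.mulVec, dotProduct, Fin.sum_univ_two] <;> ring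

theorem dual_pair_iff {m n : Submodule ℤ K} {x y : K} :
    (x ∈ dual m ∧ y ∈ dual n) ↔
      ∀ r ∈ dirSum m n, ∃ k : ℤ, (k : ℚ) = Algebra.trace ℚ K (r 0 * x + r 1 * y) := by
  constructor
  · rintro ⟨hx, hy⟩ r ⟨h0, h1⟩
    obtain ⟨k, hk⟩ := mem_dual.1 hx _ h0
    obtain ⟨l, hl⟩ := mem_dual.1 hy _ h1
    exact ⟨k + l, by rw [map_add, mul_comm (r 0), mul_comm (r 1), ← hk, ← hl]; push_cast; rfl⟩
  · intro h
    constructor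
    · rw [mem_dual]
      intro a ha
      obtain ⟨k, hk⟩ := h ![a, 0] ⟨by simpa using ha, by simp⟩
      exact ⟨k, by rw [hk]; simp [mul_comm]⟩
    · rw [mem_dual]
      intro a ha
      obtain ⟨k, hk⟩ := h ![0, a] ⟨by simp, by simpa using ha⟩
      exact ⟨k, by rw [hk]; simp [mul_comm]⟩

/-- The upper right action of `GL(𝔪 ⊕ 𝔫)` preserves `(𝔪* 𝔪; 𝔫* 𝔫)`. -/
theorem upperAct_mem {m n : Submodule ℤ K} {γ : GL (Fin 2) K} (hγ : γ ∈ latticeGL m n)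
    {X : Matrix (Fin 2) (Fin 2) K} (hX : X ∈ paramLattice m n) :
    upperAct X γ ∈ paramLattice m n := by
  obtain ⟨hu, hv⟩ := hX
  constructor
  · rw [dual_pair_iff] at hu ⊢
    intro r hr
    have hr' : r ᵥ* ((γ⁻¹ : GL (Fin 2) K) : Matrix (Fin 2) (Fin 2) K) ∈ dirSum m n := by
      have h := (latticeGL m n).inv_mem hγ
      have h' : rowMul (dirSum m n) γ⁻¹ = dirSum m n := h
      rw [← h']
      exact mem_rowMul.2 ⟨r, hr, rfl⟩
    obtain ⟨k, hk⟩ := hu _ hr'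
    refine ⟨k, hk.trans ?_⟩
    congr 1
    simp only [upperAct, Matrix.of_apply, if_true, Matrix.mulVec, Matrix.vecMul, dotProduct,
      Fin.sum_univ_two]
    ring
  · have h' : rowMul (dirSum m n) γ = dirSum m n := hγ
    have : (fun k => X k 1) ᵥ* (γ : Matrix (Fin 2) (Fin 2) K) ∈ dirSum m n := by
      rw [← h']
      exact mem_rowMul.2 ⟨_, hv, rfl⟩
    obtain ⟨h0, h1⟩ := this
    constructor
    · simpa [upperAct, Matrix.mulVec_transpose] using h0
    · simpa [upperAct, Matrix.mulVec_transpose] using h1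

theorem upperAct_stab_mul {m n : Submodule ℤ K} (c : ℕ) {U : Matrix (Fin 2) (Fin 2) K}
    {γ δ : GL (Fin 2) K} (hδ : δ ∈ latticeGL m n)
    (h₁ : ∃ Y ∈ paramLattice m n, upperAct U γ - U = c • Y)
    (h₂ : ∃ Y ∈ paramLattice m n, upperAct U δ - U = c • Y) :
    ∃ Y ∈ paramLattice m n, upperAct U (γ * δ) - U = c • Y := by
  obtain ⟨Y, hY, e⟩ := h₁
  obtain ⟨Z, hZ, f⟩ := h₂
  refine ⟨upperAct Y δ + Z, add_mem (upperAct_mem hδ hY) hZ, ?_⟩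
  rw [smul_add, ← f, ← upperAct_smul, ← e, upperAct_sub, upperAct_mul]
  abel

theorem upperAct_stab_inv {m n : Submodule ℤ K} (c : ℕ) {U : Matrix (Fin 2) (Fin 2) K}
    {γ : GL (Fin 2) K} (hγ : γ ∈ latticeGL m n)
    (h : ∃ Y ∈ paramLattice m n, upperAct U γ - U = c • Y) :
    ∃ Y ∈ paramLattice m n, upperAct U γ⁻¹ - U = c • Y := by
  obtain ⟨Y, hY, e⟩ := h
  refine ⟨-upperAct Y γ⁻¹,
    neg_mem (upperAct_mem ((latticeGL m n).inv_mem hγ) hY), ?_⟩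
  rw [smul_neg, ← upperAct_smul, ← e, upperAct_sub, ← upperAct_mul, mul_inv_cancel,
    upperAct_one]
  abel

/-- `Γ_U(𝔪,𝔫) = {γ ∈ GL(𝔪 ⊕ 𝔫) : U^γ - U ∈ (𝔪* 𝔪; 𝔫* 𝔫)}`. -/
noncomputable def Gam (m n : Submodule ℤ K) (U : Matrix (Fin 2) (Fin 2) K) :
    Subgroup (GL (Fin 2) K) where
  carrier := {γ | γ ∈ latticeGL m n ∧ upperAct U γ - U ∈ paramLattice m n}
  one_mem' := ⟨one_mem _, by simp [upperAct_one]⟩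
  mul_mem' := by
    rintro γ δ ⟨hγ, h⟩ ⟨hδ, h'⟩
    obtain ⟨Y, hY, e⟩ := upperAct_stab_mul 1 hδ ⟨_, h, (one_smul ℕ _).symm⟩
      ⟨_, h', (one_smul ℕ _).symm⟩
    exact ⟨mul_mem hγ hδ, by rw [e, one_smul]; exact hY⟩
  inv_mem' := by
    rintro γ ⟨hγ, h⟩
    obtain ⟨Y, hY, e⟩ := upperAct_stab_inv 1 hγ ⟨_, h, (one_smul ℕ _).symm⟩
    exact ⟨inv_mem hγ, by rw [e, one_smul]; exact hY⟩

/-- `Γ_U(𝔪,𝔫;N) = {γ ∈ Γ_U(𝔪,𝔫) : U^γ - U ∈ N·(𝔪* 𝔪; 𝔫* 𝔫)}`. -/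
noncomputable def GamN (m n : Submodule ℤ K) (U : Matrix (Fin 2) (Fin 2) K) (N : ℕ) :
    Subgroup (GL (Fin 2) K) where
  carrier := {γ | γ ∈ Gam m n U ∧ ∃ Y ∈ paramLattice m n, upperAct U γ - U = N • Y}
  one_mem' := ⟨one_mem _, 0, zero_mem _, by simp [upperAct_one]⟩
  mul_mem' := by
    rintro γ δ ⟨hγ, h⟩ ⟨hδ, h'⟩
    exact ⟨mul_mem hγ hδ, upperAct_stab_mul N hδ.1 h h'⟩
  inv_mem' := by
    rintro γ ⟨hγ, h⟩
    exact ⟨inv_mem hγ, upperAct_stab_inv N hγ.1 h⟩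

/-- `f₁ = [𝒱_U⁺(𝔪 ⊕ 𝔫) : 𝒱_U⁺(𝔪 ⊕ 𝔫) ∩ 𝒱_{U'}⁺(𝔪' ⊕ 𝔫')]`; exchanging the two triples
gives `f₂`. -/
noncomputable def unitIndex (m n : Submodule ℤ K) (U : Matrix (Fin 2) (Fin 2) K)
    (m' n' : Submodule ℤ K) (U' : Matrix (Fin 2) (Fin 2) K) : ℕ :=
  (unitGroupPos m' n' U').relIndex (unitGroupPos m n U)

/-- For `U'' = U - U'`, the number `exp(-2πi Tr(u₁''v₁ + u₂''v₂))`. -/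
noncomputable def zetaFactor (U U' : Matrix (Fin 2) (Fin 2) K) : ℂ :=
  Complex.exp (-(2 * Real.pi * Complex.I *
    ((Algebra.trace ℚ K ((U 0 0 - U' 0 0) * U 0 1 + (U 1 0 - U' 1 0) * U 1 1) : ℚ) : ℂ)))

end Lattices

/-! ### The space `K_ℂ^±`, automorphy factors and the slash action

Tuples are indexed by the set `K →+* ℝ` of real embeddings of the totally real field `K`. -/

section Slash

variable (K : Type*) [Field K] [NumberField K]

/-- `K_ℂ^± = (ℂ ∖ ℝ)^g`. -/
def KCpm : Set ((K →+* ℝ) → ℂ) := {z | ∀ σ, (z σ).im ≠ 0}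

/-- The group `𝒢(ℝ) = GL₂(ℝ)^g`. -/
abbrev GR : Type _ := (K →+* ℝ) → GL (Fin 2) ℝ

/-- The inclusion of `GL₂(K)` in `𝒢(ℝ)`. -/
def toGR : GL (Fin 2) K →* GR K :=
  MonoidHom.pi fun σ => Matrix.GeneralLinearGroup.map σ

variable {K}

/-- The automorphy factor `j(γ,z) = (c_σ z_σ + d_σ)_σ`. -/
noncomputable def autJ (γ : GR K) (z : (K →+* ℝ) → ℂ) : (K →+* ℝ) → ℂ :=
  fun σ => (((γ σ : Matrix (Fin 2) (Fin 2) ℝ) 1 0 : ℝ) : ℂ) * z σ +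
    (((γ σ : Matrix (Fin 2) (Fin 2) ℝ) 1 1 : ℝ) : ℂ)

/-- The componentwise Möbius action. -/
noncomputable def moeb (γ : GR K) (z : (K →+* ℝ) → ℂ) : (K →+* ℝ) → ℂ :=
  fun σ => ((((γ σ : Matrix (Fin 2) (Fin 2) ℝ) 0 0 : ℝ) : ℂ) * z σ +
    (((γ σ : Matrix (Fin 2) (Fin 2) ℝ) 0 1 : ℝ) : ℂ)) / autJ γ z σ

/-- The monomial `P(α,β;z) = ∏ z_σ^{α_σ} (z̄_σ)^{β_σ}` for `z ∈ (ℂˣ)^g`. Powers are taken with the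
principal logarithm; at a negative real coordinate both powers are the limits from the upper half
plane, so that `log z̄` is read as the conjugate of `log z` (with `arg z = π`). -/
noncomputable def monomialP (α β z : (K →+* ℝ) → ℂ) : ℂ :=
  ∏ σ, (Complex.exp (α σ * Complex.log (z σ)) *
    Complex.exp (β σ * (starRingEnd ℂ) (Complex.log (z σ))))

/-- `|x|^μ = ∏ |x_σ|^{μ_σ}` for a real tuple `x`. -/
noncomputable def absPow (x : (K →+* ℝ) → ℝ) (μ : (K →+* ℝ) → ℂ) : ℂ :=
  ∏ σ, ((|x σ| : ℝ) : ℂ) ^ μ σ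

/-- The determinant vector of `γ ∈ 𝒢(ℝ)`. -/
noncomputable def detV (γ : GR K) : (K →+* ℝ) → ℝ :=
  fun σ => (γ σ : Matrix (Fin 2) (Fin 2) ℝ).det

/-- The slash action
`F|_{{[α,β];μ},γ}(z) = j(γ,z)^{-α} j(γ,z̄)^{-β} |det γ|^{-μ} F(γz)`. -/
noncomputable def slash (α β μ : (K →+* ℝ) → ℂ) (F : ((K →+* ℝ) → ℂ) → ℂ) (γ : GR K)
    (z : (K →+* ℝ) → ℂ) : ℂ :=
  monomialP (-α) (-β) (autJ γ z) * absPow (detV γ) (-μ) * F (moeb γ z)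

/-- `F` is almost of bi-weight `{[α,β];μ}` relative to `Γ`: the multiplier is a root of unity which
depends only on `γ` and on the connected component of `K_ℂ^±` containing `z`, i.e. on the signs of
the imaginary parts of `z`. -/
def IsAlmostOfBiWeight (α β μ : (K →+* ℝ) → ℂ) (Γ : Subgroup (GR K))
    (F : ((K →+* ℝ) → ℂ) → ℂ) : Prop :=
  ∀ γ ∈ Γ, ∃ ζ : ((K →+* ℝ) → SignType) → ℂ, (∀ c, ∃ k : ℕ, 0 < k ∧ ζ c ^ k = 1) ∧
    ∀ z ∈ KCpm K, slash α β μ F γ z = ζ (fun σ => SignType.sign (z σ).im) * F z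

/-- `F` is of bi-weight `{[α,β];μ}` relative to `Γ`. -/
def IsOfBiWeight (α β μ : (K →+* ℝ) → ℂ) (Γ : Subgroup (GR K))
    (F : ((K →+* ℝ) → ℂ) → ℂ) : Prop :=
  ∀ γ ∈ Γ, ∀ z ∈ KCpm K, slash α β μ F γ z = F z

end Slash

/-! ### The Eisenstein series -/

section Eisenstein

variable {K : Type*} [Field K] [NumberField K]

/-- `α(s) = (s + w)·1 - p/2`. -/
noncomputable def wtA (p : (K →+* ℝ) → ℤ) (w : ℤ) (s : ℂ) : (K →+* ℝ) → ℂ :=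
  fun σ => s + w - (p σ : ℂ) / 2

/-- `β(s) = s·1 + p/2`. -/
noncomputable def wtB (p : (K →+* ℝ) → ℤ) (s : ℂ) : (K →+* ℝ) → ℂ :=
  fun σ => s + (p σ : ℂ) / 2

/-- The punctured shifted lattice `(𝔪 + v₁, 𝔫 + v₂) ∖ {(0,0)}`. -/
def ShiftedPairs (m n : Submodule ℤ K) (U : Matrix (Fin 2) (Fin 2) K) : Type _ :=
  {x : K × K // (x.1 - U 0 1 ∈ m ∧ x.2 - U 1 1 ∈ n) ∧ x ≠ 0}

/-- The relation of lying in one orbit of the diagonal action of `𝒱_U⁺(𝔪 ⊕ 𝔫)`. -/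
def orbitSetoid (m n : Submodule ℤ K) (U : Matrix (Fin 2) (Fin 2) K) :
    Setoid (ShiftedPairs m n U) where
  r x y := ∃ e ∈ unitGroupPos m n U, y.1.1 = (e : K) * x.1.1 ∧ y.1.2 = (e : K) * x.1.2
  iseqv :=
    { refl := fun x => ⟨1, one_mem _, by simp, by simp⟩
      symm := by
        rintro x y ⟨e, he, h1, h2⟩
        exact ⟨e⁻¹, inv_mem he, by rw [h1]; simp, by rw [h2]; simp⟩
      trans := by
        rintro x y z ⟨e, he, h1, h2⟩ ⟨f, hf, g1, g2⟩
        exact ⟨f * e, mul_mem hf he, by rw [g1, h1]; simp [mul_assoc],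
          by rw [g2, h2]; simp [mul_assoc]⟩ }

/-- The set of orbits indexing the series. -/
def Orbits (m n : Submodule ℤ K) (U : Matrix (Fin 2) (Fin 2) K) : Type _ :=
  Quotient (orbitSetoid m n U)

/-- The term of the series at the pair `(a,b) = (m + v₁, n + v₂)`:
`e^{2πi Tr(u₁a + u₂b)} |y|^{s·1} / P(α(s),β(s); az + b)`. -/
noncomputable def eisTerm (U : Matrix (Fin 2) (Fin 2) K) (p : (K →+* ℝ) → ℤ) (w : ℤ)
    (z : (K →+* ℝ) → ℂ) (s : ℂ) (x : K × K) : ℂ :=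
  Complex.exp (2 * Real.pi * Complex.I *
      ((Algebra.trace ℚ K (U 0 0 * x.1 + U 1 0 * x.2) : ℚ) : ℂ)) *
    absPow (fun σ => (z σ).im) (fun _ => s) /
    monomialP (wtA p w s) (wtB p s) (fun σ => ((σ x.1 : ℝ) : ℂ) * z σ + ((σ x.2 : ℝ) : ℂ))

/-- The term at a chosen representative of an orbit (the choice does not matter, since the terms
are constant on the orbits). -/
noncomputable def orbitTerm (m n : Submodule ℤ K) (U : Matrix (Fin 2) (Fin 2) K)
    (p : (K →+* ℝ) → ℤ) (w : ℤ) (z : (K →+* ℝ) → ℂ) (s : ℂ) (q : Orbits m n U) : ℂ :=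
  eisTerm U p w z s (Quotient.out q).1

/-- The series defining the Eisenstein series for `Re s > 1 - w/2`. -/
noncomputable def eisSeries (m n : Submodule ℤ K) (U : Matrix (Fin 2) (Fin 2) K)
    (p : (K →+* ℝ) → ℤ) (w : ℤ) (z : (K →+* ℝ) → ℂ) (s : ℂ) : ℂ :=
  ∑' q : Orbits m n U, orbitTerm m n U p w z s q

/-- `f` is the meromorphic continuation to `ℂ` of a function `F` given on `Re s > c`, with value
`0` at the poles. Such an `f` is unique. -/
def IsMeroCont (c : ℝ) (F f : ℂ → ℂ) : Prop :=
  MeromorphicNFOn f Set.univ ∧ ∀ s : ℂ, c < s.re → f s = F s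

open Classical in
/-- The Eisenstein series `G_{(𝔪,𝔫)}^{α(s),β(s)}(U;z)`: the sum of the series for
`Re s > 1 - w/2`, and for all other `s` the value of its meromorphic continuation in `s`
(with value `0` at the poles). -/
noncomputable def eisG (m n : Submodule ℤ K) (U : Matrix (Fin 2) (Fin 2) K)
    (p : (K →+* ℝ) → ℤ) (w : ℤ) (s : ℂ) (z : (K →+* ℝ) → ℂ) : ℂ :=
  if 1 - (w : ℝ) / 2 < s.re then eisSeries m n U p w z s
  else if h : ∃ f, IsMeroCont (1 - (w : ℝ) / 2) (eisSeries m n U p w z) f then h.choose s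
  else 0

end Eisenstein

end EisGL2

namespace EisGL2

/-! ### The monomials `P(α, β; z)` and powers of absolute values -/

section Monomials

variable {K : Type*} [Field K] [NumberField K]

/-! Everything is first proved termwise in the half plane of absolute convergence and then carried
to all `s` by uniqueness of meromorphic continuation.

Convergence. For fixed `z` the linear form `az + b` dominates the local height `max |a| |b|` at each
embedding, so a term is bounded by a function of `z` times the product of the heights to the power
`-(2 Re s + w)`. By Dirichlet's unit theorem each orbit has a member whose local heights are all
comparable (`exists_balancing_unit`). For such members the product of heights is controlled by the
g-th power of a norm on a lattice of rank `2g`, and the sum converges as soon as `2 Re s + w > 2`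
(`summable_prod_height`). The bound is locally uniform in `z`, whence continuity.

Transformation. Right multiplication by `γ` maps the shifted lattice of `U` to that of `U^γ`,
preserves the trace pairing and multiplies the linear form by `j(γ, z)`; with `Im γz = det γ · y /
|j|²` the terms match exactly (`eisFactor_mul_eisTerm`). Only the unit groups differ. They are
commensurable, because each lies in the units of `𝓞 K` and contains a fixed power of all of them,
and passing through their intersection yields the quotient of indices (`orbSum_commensurable`). The
automorphy factor is entire in `s` without zeros, so the identity passes to the continuations
(`mul_eisG_eq`).

Modularity. For `γ` in `Γ_U` the matrices `U` and `U^γ` differ by an element of the parameter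
lattice. Then the unit group and the shifted lattice are unchanged, and every term is multiplied by
the same root of unity (`eisTerm_of_sub_mem`). Discreteness holds because the matrices have bounded
denominators. -/

theorem monomialP_eq_prod {α β : (K →+* ℝ) → ℂ} {n : (K →+* ℝ) → ℤ}
    (h : ∀ σ, α σ = β σ + n σ) {z : (K →+* ℝ) → ℂ} (hz : ∀ σ, z σ ≠ 0) :
    monomialP α β z = ∏ σ, (Complex.exp (2 * β σ * (Real.log ‖z σ‖ : ℝ)) * z σ ^ n σ) := by
  refine Finset.prod_congr rfl fun σ _ => ?_
  -- Eliminating the conjugate logarithm leaves `log z` with the integral coefficient `n σ` only, so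
  -- the branch cut disappears. Multiplicativity and continuity of the monomial rest on this.
  have h1 : (starRingEnd ℂ) (Complex.log (z σ)) =
      2 * (Real.log ‖z σ‖ : ℝ) - Complex.log (z σ) := by
    have := Complex.add_conj (Complex.log (z σ))
    rw [Complex.log_re] at this
    push_cast at this
    linear_combination this
  rw [h1, h σ, ← Complex.exp_add]
  have h2 : z σ ^ n σ = Complex.exp (n σ * Complex.log (z σ)) := by
    rw [Complex.exp_int_mul, Complex.exp_log (hz σ)]
  rw [h2, ← Complex.exp_add]
  congr 1
  ring

theorem monomialP_neg (α β z : (K →+* ℝ) → ℂ) :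
    monomialP (-α) (-β) z = (monomialP α β z)⁻¹ := by
  simp only [monomialP, ← Finset.prod_inv_distrib]
  refine Finset.prod_congr rfl fun σ _ => ?_
  rw [mul_inv, ← Complex.exp_neg, ← Complex.exp_neg]
  simp

theorem monomialP_ne_zero (α β z : (K →+* ℝ) → ℂ) : monomialP α β z ≠ 0 :=
  Finset.prod_ne_zero_iff.2 fun _ _ => mul_ne_zero (Complex.exp_ne_zero _) (Complex.exp_ne_zero _)

theorem monomialP_mul {α β : (K →+* ℝ) → ℂ} {n : (K →+* ℝ) → ℤ}
    (h : ∀ σ, α σ = β σ + n σ) {z w : (K →+* ℝ) → ℂ} (hz : ∀ σ, z σ ≠ 0) (hw : ∀ σ, w σ ≠ 0) :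
    monomialP α β (fun σ => z σ * w σ) = monomialP α β z * monomialP α β w := by
  rw [monomialP_eq_prod h hz, monomialP_eq_prod h hw,
    monomialP_eq_prod h (fun σ => mul_ne_zero (hz σ) (hw σ)), ← Finset.prod_mul_distrib]
  refine Finset.prod_congr rfl fun σ _ => ?_
  rw [norm_mul, Real.log_mul (norm_ne_zero_iff.2 (hz σ)) (norm_ne_zero_iff.2 (hw σ)), mul_zpow]
  push_cast
  rw [mul_add, Complex.exp_add]
  ring

theorem absPow_eq_exp {x : (K →+* ℝ) → ℝ} (hx : ∀ σ, x σ ≠ 0) (μ : (K →+* ℝ) → ℂ) :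
    absPow x μ = ∏ σ, Complex.exp (μ σ * (Real.log |x σ| : ℝ)) := by
  refine Finset.prod_congr rfl fun σ _ => ?_
  have : ((|x σ| : ℝ) : ℂ) ≠ 0 := by simpa using hx σ
  rw [Complex.cpow_def_of_ne_zero this, Complex.ofReal_log (abs_nonneg _), mul_comm]

theorem absPow_ne_zero {x : (K →+* ℝ) → ℝ} (hx : ∀ σ, x σ ≠ 0) (μ : (K →+* ℝ) → ℂ) :
    absPow x μ ≠ 0 := by
  rw [absPow_eq_exp hx]
  exact Finset.prod_ne_zero_iff.2 fun _ _ => Complex.exp_ne_zero _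

theorem wt_sub (p : (K →+* ℝ) → ℤ) (w : ℤ) (s : ℂ) (σ : K →+* ℝ) :
    wtA p w s σ = wtB p s σ + ((w - p σ : ℤ) : ℂ) := by
  simp only [wtA, wtB]
  push_cast
  ring

/-- The contributions of `p` to `2 Re β` and to `α - β` cancel, so the size depends on `2 Re s + w`
alone, with the same exponent at every embedding. -/
theorem norm_monomialP_wt (p : (K →+* ℝ) → ℤ) (w : ℤ) (s : ℂ) {z : (K →+* ℝ) → ℂ}
    (hz : ∀ σ, z σ ≠ 0) :
    ‖monomialP (wtA p w s) (wtB p s) z‖ = ∏ σ, ‖z σ‖ ^ (2 * s.re + w) := by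
  rw [monomialP_eq_prod (wt_sub p w s) hz, norm_prod]
  refine Finset.prod_congr rfl fun σ _ => ?_
  have h0 : 0 < ‖z σ‖ := norm_pos_iff.2 (hz σ)
  rw [norm_mul, Complex.norm_exp, norm_zpow, ← Real.rpow_intCast, Real.rpow_def_of_pos h0,
    Real.rpow_def_of_pos h0, ← Real.exp_add]
  congr 1
  have : (2 * wtB p s σ * ((Real.log ‖z σ‖ : ℝ) : ℂ)).re =
      (2 * s.re + p σ) * Real.log ‖z σ‖ := by
    rw [Complex.re_mul_ofReal]
    simp [wtB]
    left
    ring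
  rw [this]
  push_cast
  ring

/-- Weights at `s` differ from those at `0` by a power of the absolute values. -/
theorem monomialP_wt_eq (p : (K →+* ℝ) → ℤ) (w : ℤ) (s : ℂ) {z : (K →+* ℝ) → ℂ}
    (hz : ∀ σ, z σ ≠ 0) :
    monomialP (wtA p w s) (wtB p s) z =
      monomialP (fun σ => (w : ℂ) - (p σ : ℂ) / 2) (fun σ => (p σ : ℂ) / 2) z *
        absPow (fun σ => ‖z σ‖) (fun _ => 2 * s) := by
  have h : ∀ σ, (w : ℂ) - (p σ : ℂ) / 2 = (p σ : ℂ) / 2 + ((w - p σ : ℤ) : ℂ) := by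
    intro σ; push_cast; ring
  rw [monomialP_eq_prod (wt_sub p w s) hz, monomialP_eq_prod h hz,
    absPow_eq_exp (fun σ => norm_ne_zero_iff.2 (hz σ)), ← Finset.prod_mul_distrib]
  refine Finset.prod_congr rfl fun σ _ => ?_
  rw [abs_norm, mul_right_comm (Complex.exp _) (_ ^ _), ← Complex.exp_add]
  congr 2
  simp only [wtB]
  ring

/-- Meant for totally positive units `r`: there `α σ + β σ` does not depend on `σ`, and the extra
factor is a power of the norm. -/
theorem monomialP_smul_real {α β : (K →+* ℝ) → ℂ} {n : (K →+* ℝ) → ℤ}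
    (h : ∀ σ, α σ = β σ + n σ) {z : (K →+* ℝ) → ℂ} (hz : ∀ σ, z σ ≠ 0) {r : (K →+* ℝ) → ℝ}
    (hr : ∀ σ, 0 < r σ) :
    monomialP α β (fun σ => (r σ : ℂ) * z σ) =
      (∏ σ, Complex.exp ((α σ + β σ) * (Real.log (r σ) : ℝ))) * monomialP α β z := by
  rw [monomialP_mul h (fun σ => by exact_mod_cast (hr σ).ne') hz]
  congr 1
  refine Finset.prod_congr rfl fun σ _ => ?_
  rw [← Complex.ofReal_log (hr σ).le, Complex.conj_ofReal, ← Complex.exp_add, add_mul]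

end Monomials

/-! ### Behaviour of a single term under `GL₂(K)` -/

section Moebius

variable {K : Type*} [Field K] [NumberField K]

theorem linear_form_ne_zero {z : (K →+* ℝ) → ℂ} (hz : z ∈ KCpm K) {x : K × K} (hx : x ≠ 0)
    (σ : K →+* ℝ) : ((σ x.1 : ℝ) : ℂ) * z σ + ((σ x.2 : ℝ) : ℂ) ≠ 0 := by
  intro h
  have h1 := congrArg Complex.im h
  have h2 := congrArg Complex.re h
  simp only [Complex.add_im, Complex.im_ofReal_mul, Complex.ofReal_im, add_zero, Complex.zero_im,
    mul_eq_zero, hz σ, or_false, map_eq_zero] at h1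
  simp only [h1, map_zero, Complex.ofReal_zero, zero_mul, zero_add, Complex.ofReal_re,
    Complex.zero_re, map_eq_zero] at h2
  exact hx (Prod.ext h1 h2)

@[simp]
theorem toGR_apply (γ : GL (Fin 2) K) (σ : K →+* ℝ) (i j : Fin 2) :
    ((toGR K γ σ : GL (Fin 2) ℝ) : Matrix (Fin 2) (Fin 2) ℝ) i j =
      σ ((γ : Matrix (Fin 2) (Fin 2) K) i j) := rfl

theorem detV_toGR (γ : GL (Fin 2) K) (σ : K →+* ℝ) :
    detV (toGR K γ) σ = σ (γ : Matrix (Fin 2) (Fin 2) K).det := by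
  simp [detV, Matrix.det_fin_two]

theorem detV_toGR_ne_zero (γ : GL (Fin 2) K) (σ : K →+* ℝ) : detV (toGR K γ) σ ≠ 0 := by
  rw [detV_toGR, map_ne_zero]
  exact ((Matrix.isUnit_iff_isUnit_det _).1 γ.isUnit).ne_zero

theorem autJ_ne_zero {z : (K →+* ℝ) → ℂ} (hz : z ∈ KCpm K) (γ : GL (Fin 2) K) (σ : K →+* ℝ) :
    autJ (toGR K γ) z σ ≠ 0 := by
  refine linear_form_ne_zero hz (x := ((γ : Matrix (Fin 2) (Fin 2) K) 1 0,
    (γ : Matrix (Fin 2) (Fin 2) K) 1 1)) (fun h => ?_) σ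
  rw [Prod.ext_iff] at h
  have := ((Matrix.isUnit_iff_isUnit_det _).1 γ.isUnit).ne_zero
  rw [Matrix.det_fin_two] at this
  simp only [Prod.fst_zero, Prod.snd_zero] at h
  rw [h.1, h.2] at this
  simp at this

theorem moeb_im {z : (K →+* ℝ) → ℂ} (hz : z ∈ KCpm K) (γ : GL (Fin 2) K) (σ : K →+* ℝ) :
    (moeb (toGR K γ) z σ).im =
      detV (toGR K γ) σ * (z σ).im / ‖autJ (toGR K γ) z σ‖ ^ 2 := by
  have hj := autJ_ne_zero hz γ σ
  have hn : Complex.normSq (autJ (toGR K γ) z σ) ≠ 0 := by simpa using hj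
  rw [moeb, Complex.div_im, ← Complex.normSq_eq_norm_sq, ← sub_div]
  congr 1
  rw [detV, Matrix.det_fin_two]
  simp only [autJ, Complex.add_im, Complex.add_re, Complex.im_ofReal_mul, Complex.re_ofReal_mul,
    Complex.ofReal_im, Complex.ofReal_re]
  ring

theorem moeb_mem {z : (K →+* ℝ) → ℂ} (hz : z ∈ KCpm K) (γ : GL (Fin 2) K) :
    moeb (toGR K γ) z ∈ KCpm K := by
  intro σ
  rw [moeb_im hz]
  exact div_ne_zero (mul_ne_zero (detV_toGR_ne_zero γ σ) (hz σ))
    (pow_ne_zero _ (norm_ne_zero_iff.2 (autJ_ne_zero hz γ σ)))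

/-- Right multiplication of a pair, regarded as a row vector, by a matrix. -/
def pairMul (γ : GL (Fin 2) K) (x : K × K) : K × K :=
  (x.1 * (γ : Matrix (Fin 2) (Fin 2) K) 0 0 + x.2 * (γ : Matrix (Fin 2) (Fin 2) K) 1 0,
    x.1 * (γ : Matrix (Fin 2) (Fin 2) K) 0 1 + x.2 * (γ : Matrix (Fin 2) (Fin 2) K) 1 1)

theorem pairMul_mul (γ δ : GL (Fin 2) K) (x : K × K) :
    pairMul (γ * δ) x = pairMul δ (pairMul γ x) := by
  simp only [pairMul, Units.val_mul, Matrix.mul_apply, Fin.sum_univ_two, Prod.mk.injEq]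
  constructor <;> ring

theorem pairMul_one (x : K × K) : pairMul (1 : GL (Fin 2) K) x = x := by
  simp [pairMul]

theorem pairMul_zero (γ : GL (Fin 2) K) : pairMul γ 0 = 0 := by
  simp [pairMul]

theorem pairMul_eq_zero {γ : GL (Fin 2) K} {x : K × K} : pairMul γ x = 0 ↔ x = 0 := by
  constructor
  · intro h
    rw [← pairMul_one x, ← mul_inv_cancel γ, pairMul_mul, h, pairMul_zero]
  · rintro rfl
    exact pairMul_zero γ

/-- The column `(z, 1)` is sent by `γ` to `j(γ, z)` times `(γz, 1)`; multiply by the row `x` on the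
left. -/
theorem linear_form_pairMul {z : (K →+* ℝ) → ℂ} (hz : z ∈ KCpm K) (γ : GL (Fin 2) K)
    (x : K × K) (σ : K →+* ℝ) :
    ((σ (pairMul γ x).1 : ℝ) : ℂ) * z σ + ((σ (pairMul γ x).2 : ℝ) : ℂ) =
      autJ (toGR K γ) z σ *
        (((σ x.1 : ℝ) : ℂ) * moeb (toGR K γ) z σ + ((σ x.2 : ℝ) : ℂ)) := by
  have hj := autJ_ne_zero hz γ σ
  have h : autJ (toGR K γ) z σ * moeb (toGR K γ) z σ =
      ((σ ((γ : Matrix (Fin 2) (Fin 2) K) 0 0) : ℝ) : ℂ) * z σ +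
        ((σ ((γ : Matrix (Fin 2) (Fin 2) K) 0 1) : ℝ) : ℂ) := by
    rw [moeb, mul_div_cancel₀ _ hj]
    rfl
  have h' : autJ (toGR K γ) z σ = ((σ ((γ : Matrix (Fin 2) (Fin 2) K) 1 0) : ℝ) : ℂ) * z σ +
        ((σ ((γ : Matrix (Fin 2) (Fin 2) K) 1 1) : ℝ) : ℂ) := rfl
  rw [mul_add, mul_left_comm, h, h']
  simp only [pairMul, map_add, map_mul, Complex.ofReal_add, Complex.ofReal_mul]
  ring

/-- The row is multiplied by `γ` and the column of the `u` by `γ⁻¹`, so the pairing is unchanged. -/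
theorem upperAct_pairing (U : Matrix (Fin 2) (Fin 2) K) (γ : GL (Fin 2) K) (x : K × K) :
    upperAct U γ 0 0 * (pairMul γ x).1 + upperAct U γ 1 0 * (pairMul γ x).2 =
      U 0 0 * x.1 + U 1 0 * x.2 := by
  have h : ((γ : Matrix (Fin 2) (Fin 2) K) * ((γ⁻¹ : GL (Fin 2) K) : Matrix (Fin 2) (Fin 2) K)) =
      1 := by
    rw [← Units.val_mul, mul_inv_cancel, Units.val_one]
  have h00 := congrFun (congrFun h 0) 0
  have h01 := congrFun (congrFun h 0) 1
  have h10 := congrFun (congrFun h 1) 0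
  have h11 := congrFun (congrFun h 1) 1
  simp only [Matrix.mul_apply, Fin.sum_univ_two, Matrix.one_apply_eq, ne_eq, zero_ne_one,
    not_false_eq_true, Matrix.one_apply_ne, one_ne_zero] at h00 h01 h10 h11
  simp only [upperAct, Matrix.of_apply, if_true, Matrix.mulVec, dotProduct, Fin.sum_univ_two,
    pairMul]
  linear_combination x.1 * U 0 0 * h00 + x.1 * U 1 0 * h01 + x.2 * U 0 0 * h10 + x.2 * U 1 0 * h11

/-- The automorphy factor in the transformation formula of the Eisenstein series. -/
noncomputable def eisFactor (p : (K →+* ℝ) → ℤ) (w : ℤ) (γ : GL (Fin 2) K)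
    (z : (K →+* ℝ) → ℂ) (s : ℂ) : ℂ :=
  monomialP (-wtA p w s) (-wtB p s) (autJ (toGR K γ) z) *
    absPow (fun σ => ‖autJ (toGR K γ) z σ‖) (fun _ => 2 * s) *
    absPow (detV (toGR K γ)) (fun _ => -s)

theorem eisFactor_ne_zero (p : (K →+* ℝ) → ℤ) (w : ℤ) (γ : GL (Fin 2) K)
    {z : (K →+* ℝ) → ℂ} (hz : z ∈ KCpm K) (s : ℂ) : eisFactor p w γ z s ≠ 0 :=
  mul_ne_zero (mul_ne_zero (monomialP_ne_zero _ _ _)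
    (absPow_ne_zero (fun σ => norm_ne_zero_iff.2 (autJ_ne_zero hz γ σ)) _))
    (absPow_ne_zero (detV_toGR_ne_zero γ) _)

theorem analyticOnNhd_eisFactor (p : (K →+* ℝ) → ℤ) (w : ℤ) (γ : GL (Fin 2) K)
    {z : (K →+* ℝ) → ℂ} (hz : z ∈ KCpm K) :
    AnalyticOnNhd ℂ (eisFactor p w γ z) Set.univ := by
  have h : eisFactor p w γ z = fun s =>
      (∏ σ, (Complex.exp ((-wtA p w s) σ * Complex.log (autJ (toGR K γ) z σ)) *
        Complex.exp ((-wtB p s) σ * (starRingEnd ℂ) (Complex.log (autJ (toGR K γ) z σ))))) *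
      (∏ σ, Complex.exp (2 * s * (Real.log |‖autJ (toGR K γ) z σ‖| : ℝ))) *
      ∏ σ, Complex.exp (-s * (Real.log |detV (toGR K γ) σ| : ℝ)) := by
    funext s
    rw [eisFactor, absPow_eq_exp (detV_toGR_ne_zero γ),
      absPow_eq_exp (fun σ => norm_ne_zero_iff.2 (autJ_ne_zero hz γ σ))]
    rfl
  rw [h]
  refine Complex.analyticOnNhd_univ_iff_differentiable.2 ?_
  simp only [wtA, wtB, Pi.neg_apply]
  fun_prop

/-- `j^{-α(s)} j̄^{-β(s)} |j|^{2s}` is the automorphy factor of the weight at `s = 0`. -/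
theorem eisFactor_eq (p : (K →+* ℝ) → ℤ) (w : ℤ) (γ : GL (Fin 2) K)
    {z : (K →+* ℝ) → ℂ} (hz : z ∈ KCpm K) (s : ℂ) :
    eisFactor p w γ z s =
      monomialP (-fun σ => (w : ℂ) - (p σ : ℂ) / 2) (-fun σ => (p σ : ℂ) / 2)
        (autJ (toGR K γ) z) * absPow (detV (toGR K γ)) (-fun _ => s) := by
  rw [eisFactor, monomialP_neg, monomialP_neg, monomialP_wt_eq p w s (autJ_ne_zero hz γ), mul_inv,
    inv_mul_cancel_right₀ (absPow_ne_zero (fun σ => norm_ne_zero_iff.2 (autJ_ne_zero hz γ σ)) _)]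
  rfl

theorem eisFactor_mul_eisTerm (U : Matrix (Fin 2) (Fin 2) K) (p : (K →+* ℝ) → ℤ) (w : ℤ)
    (γ : GL (Fin 2) K) {z : (K →+* ℝ) → ℂ} (hz : z ∈ KCpm K) (s : ℂ) {x : K × K} (hx : x ≠ 0) :
    eisFactor p w γ z s * eisTerm U p w (moeb (toGR K γ) z) s x =
      eisTerm (upperAct U γ) p w z s (pairMul γ x) := by
  have hj := autJ_ne_zero hz γ
  -- By `moeb_im` the factors `|j|^{2s}` and `|det γ|^{-s}` turn `|Im γz|^s` into `|y|^s`.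
  have hy : absPow (fun σ => ‖autJ (toGR K γ) z σ‖) (fun _ => 2 * s) *
      absPow (detV (toGR K γ)) (fun _ => -s) *
      absPow (fun σ => (moeb (toGR K γ) z σ).im) (fun _ => s) =
      absPow (fun σ => (z σ).im) (fun _ => s) := by
    rw [absPow_eq_exp (fun σ => norm_ne_zero_iff.2 (hj σ)), absPow_eq_exp (detV_toGR_ne_zero γ),
      absPow_eq_exp (moeb_mem hz γ), absPow_eq_exp (fun σ => hz σ), ← Finset.prod_mul_distrib,
      ← Finset.prod_mul_distrib]
    refine Finset.prod_congr rfl fun σ _ => ?_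
    rw [← Complex.exp_add, ← Complex.exp_add, moeb_im hz, abs_div, abs_mul, abs_pow,
      Real.log_div (mul_ne_zero (abs_ne_zero.2 (detV_toGR_ne_zero γ σ)) (abs_ne_zero.2 (hz σ)))
        (pow_ne_zero _ (abs_ne_zero.2 (norm_ne_zero_iff.2 (hj σ)))),
      Real.log_mul (abs_ne_zero.2 (detV_toGR_ne_zero γ σ)) (abs_ne_zero.2 (hz σ)), Real.log_pow]
    congr 1
    push_cast
    ring
  have hP : monomialP (wtA p w s) (wtB p s)
        (fun σ => ((σ (pairMul γ x).1 : ℝ) : ℂ) * z σ + ((σ (pairMul γ x).2 : ℝ) : ℂ)) =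
      monomialP (wtA p w s) (wtB p s) (autJ (toGR K γ) z) * monomialP (wtA p w s) (wtB p s)
        (fun σ => ((σ x.1 : ℝ) : ℂ) * moeb (toGR K γ) z σ + ((σ x.2 : ℝ) : ℂ)) := by
    rw [← monomialP_mul (wt_sub p w s) hj (linear_form_ne_zero (moeb_mem hz γ) hx)]
    congr 1
    funext σ
    exact linear_form_pairMul hz γ x σ
  rw [eisTerm, eisTerm, hP, upperAct_pairing, ← hy, eisFactor, monomialP_neg]
  field_simp

end Moebius

open NumberField

/-! ### Real embeddings as infinite places -/

section Places

variable {K : Type*} [Field K]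

/-- The infinite place given by a real embedding. -/
noncomputable def realPlace (σ : K →+* ℝ) : InfinitePlace K :=
  InfinitePlace.mk (Complex.ofRealHom.comp σ)

theorem realPlace_apply (σ : K →+* ℝ) (x : K) : realPlace σ x = |σ x| := by
  rw [realPlace, InfinitePlace.apply]
  simp

theorem realPlace_bijective [IsTotallyReal K] :
    Function.Bijective (realPlace : (K →+* ℝ) → InfinitePlace K) := by
  constructor
  · intro σ τ h
    ext x
    rcases InfinitePlace.mk_eq_iff.1 h with h | h
    · simpa using RingHom.congr_fun h x
    · simpa [ComplexEmbedding.conjugate_coe_eq] using RingHom.congr_fun h x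
  · intro v
    refine ⟨InfinitePlace.embedding_of_isReal (IsTotallyReal.isReal v), ?_⟩
    ext x
    rw [realPlace_apply, ← Real.norm_eq_abs, InfinitePlace.norm_embedding_of_isReal]

variable (K) in
/-- Real embeddings of a totally real field correspond to its infinite places. -/
noncomputable def realPlaceEquiv [IsTotallyReal K] : (K →+* ℝ) ≃ InfinitePlace K :=
  Equiv.ofBijective realPlace realPlace_bijective

theorem realPlaceEquiv_apply [IsTotallyReal K] (σ : K →+* ℝ) (x : K) :
    realPlaceEquiv K σ x = |σ x| :=
  realPlace_apply σ x

variable [NumberField K] [IsTotallyReal K]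

theorem prod_abs_embeddings (x : K) : ∏ σ : K →+* ℝ, |σ x| = |Algebra.norm ℚ x| := by
  rw [← InfinitePlace.prod_eq_abs_norm x]
  refine Fintype.prod_equiv (realPlaceEquiv K) _ _ fun σ => ?_
  rw [realPlaceEquiv_apply, IsTotallyReal.mult_eq, pow_one]

variable (K) in
theorem card_embeddings : Fintype.card (K →+* ℝ) = Module.finrank ℚ K := by
  classical
  rw [Fintype.card_congr (realPlaceEquiv K), IsTotallyReal.finrank,
    InfinitePlace.card_eq_nrRealPlaces_add_nrComplexPlaces,
    IsTotallyReal.nrComplexPlaces_eq_zero, add_zero]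

instance nonempty_embeddings : Nonempty (K →+* ℝ) :=
  (realPlaceEquiv K).nonempty

theorem prod_abs_unit (e : (𝓞 K)ˣ) : ∏ σ : K →+* ℝ, |σ (e : K)| = 1 := by
  rw [prod_abs_embeddings]
  have := NumberField.Units.norm (K := K) e
  exact_mod_cast this

theorem sum_log_abs_unit (e : (𝓞 K)ˣ) : ∑ σ : K →+* ℝ, Real.log |σ (e : K)| = 0 := by
  rw [← Real.log_prod, prod_abs_unit, Real.log_one]
  intro σ _
  simp

/-- A nonzero algebraic integer cannot have all conjugates smaller than one. This is the source of
discreteness, for matrix groups as well as for pairs of integers. -/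
theorem eq_zero_of_forall_abs_lt_one {x : 𝓞 K} (h : ∀ σ : K →+* ℝ, |σ (x : K)| < 1) : x = 0 := by
  by_contra hx
  obtain ⟨σ₀⟩ := nonempty_embeddings (K := K)
  have := InfinitePlace.one_le_of_lt_one (w := realPlaceEquiv K σ₀) hx fun v _ => by
    obtain ⟨σ, rfl⟩ := (realPlaceEquiv K).surjective v
    rw [realPlaceEquiv_apply]
    exact h σ
  rw [realPlaceEquiv_apply] at this
  exact absurd this (not_le.2 (h σ₀))

end Places

/-! ### Common denominators for lattices, duals and multiplier rings -/

section Denominators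

variable {K : Type*} [Field K] [NumberField K]

/-- Every element of `K` has a positive integral multiple in `B`. -/
def ClearsDenominators (B : Submodule ℤ K) : Prop :=
  ∀ x : K, ∃ d : ℕ, 0 < d ∧ (d : K) * x ∈ B

theorem natCast_mul_mem {B : Submodule ℤ K} {x : K} (d : ℕ) (h : x ∈ B) : (d : K) * x ∈ B := by
  rw [← nsmul_eq_mul]
  exact nsmul_mem h d

theorem clearsDenominators_of_isLattice (m : Submodule ℤ K) [Submodule.IsLattice ℚ m] :
    ClearsDenominators m := by
  intro x
  have hx : x ∈ Submodule.span ℚ (m : Set K) := by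
    rw [Submodule.IsLattice.span_eq_top]
    exact Submodule.mem_top
  induction hx using Submodule.span_induction with
  | mem x h => exact ⟨1, one_pos, by simpa using h⟩
  | zero => exact ⟨1, one_pos, by simp⟩
  | add x y _ _ hx hy =>
    obtain ⟨c, hc, h⟩ := hx
    obtain ⟨d, hd, h'⟩ := hy
    refine ⟨c * d, mul_pos hc hd, ?_⟩
    have := add_mem (natCast_mul_mem d h) (natCast_mul_mem c h')
    convert this using 1
    push_cast
    ring
  | smul q x _ hx =>
    obtain ⟨d, hd, h⟩ := hx
    refine ⟨q.den * d, mul_pos q.den_pos hd, ?_⟩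
    have h' := m.smul_mem q.num h
    convert h' using 1
    have : (q.den : K) * (q : K) = q.num := by exact_mod_cast Rat.den_mul_eq_num q
    rw [zsmul_eq_mul, Algebra.smul_def, eq_ratCast]
    push_cast
    linear_combination (d : K) * x * this

theorem ClearsDenominators.of_fg {A B : Submodule ℤ K} (hB : ClearsDenominators B) (hA : A.FG) :
    ∃ d : ℕ, 0 < d ∧ ∀ a ∈ A, (d : K) * a ∈ B := by
  induction A, hA using Submodule.fg_induction with
  | singleton x =>
    obtain ⟨d, hd, h⟩ := hB x
    refine ⟨d, hd, fun a ha => ?_⟩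
    obtain ⟨k, rfl⟩ := Submodule.mem_span_singleton.1 ha
    rw [mul_smul_comm]
    exact B.smul_mem k h
  | sup A₁ A₂ _ _ h₁ h₂ =>
    obtain ⟨c, hc, h⟩ := h₁
    obtain ⟨d, hd, h'⟩ := h₂
    refine ⟨c * d, mul_pos hc hd, fun a ha => ?_⟩
    obtain ⟨x, hx, y, hy, rfl⟩ := Submodule.mem_sup.1 ha
    have := add_mem (natCast_mul_mem d (h x hx)) (natCast_mul_mem c (h' y hy))
    convert this using 1
    push_cast
    ring

theorem fg_map_mul {A : Submodule ℤ K} (hA : A.FG) (c : K) :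
    (A.map (LinearMap.mulLeft ℤ c)).FG :=
  hA.map _

theorem ClearsDenominators.mult {m : Submodule ℤ K} (hm : ClearsDenominators m) (hm' : m.FG) :
    ClearsDenominators (mult m) := by
  intro x
  obtain ⟨d, hd, h⟩ := hm.of_fg (fg_map_mul hm' x)
  refine ⟨d, hd, mem_mult.2 fun y hy => ?_⟩
  rw [mul_assoc]
  exact h _ (Submodule.mem_map_of_mem (f := LinearMap.mulLeft ℤ x) hy)

theorem clearsDenominators_dual {A : Submodule ℤ K} (hA : A.FG) :
    ClearsDenominators (dual A) := by
  intro x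
  -- Elements of integral trace: that `d` moves `xA` into `B` says precisely that `dx` lies in the
  -- dual of `A`.
  let B : Submodule ℤ K := (1 : Submodule ℤ ℚ).comap ((Algebra.trace ℚ K).restrictScalars ℤ)
  have hB : ClearsDenominators B := by
    intro y
    refine ⟨(Algebra.trace ℚ K y).den, Rat.den_pos _, ?_⟩
    rw [← nsmul_eq_mul, Submodule.mem_comap, map_nsmul, Submodule.mem_one]
    refine ⟨(Algebra.trace ℚ K y).num, ?_⟩
    rw [LinearMap.restrictScalars_apply, nsmul_eq_mul, Rat.den_mul_eq_num]
    simp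
  obtain ⟨d, hd, h⟩ := hB.of_fg (fg_map_mul hA x)
  refine ⟨d, hd, mem_dual.2 fun y hy => ?_⟩
  have := h _ (Submodule.mem_map_of_mem (f := LinearMap.mulLeft ℤ x) hy)
  rw [Submodule.mem_comap, Submodule.mem_one] at this
  obtain ⟨k, hk⟩ := this
  refine ⟨k, ?_⟩
  simpa [mul_assoc] using hk

theorem exists_ne_zero_mem {m : Submodule ℤ K} (hm : ClearsDenominators m) : ∃ y ∈ m, y ≠ 0 := by
  obtain ⟨d, hd, h⟩ := hm 1
  exact ⟨_, h, by simpa using hd.ne'⟩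

/-- Multiplication by a nonzero element of `m` embeds the multiplier ring in `m`, and `ℤ` is
Noetherian. -/
theorem mult_fg {m : Submodule ℤ K} (hm : ClearsDenominators m) (hm' : m.FG) : (mult m).FG := by
  obtain ⟨y, hy, hy0⟩ := exists_ne_zero_mem hm
  refine Submodule.fg_of_fg_map_injective (LinearMap.mulRight ℤ y)
    (mul_left_injective₀ hy0) (hm'.of_le ?_)
  rintro _ ⟨x, hx, rfl⟩
  exact mem_mult.1 hx y hy

variable (K) in
/-- The ring of integers as a `ℤ`-submodule of `K`. -/
noncomputable def integers : Submodule ℤ K :=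
  LinearMap.range (Algebra.linearMap (𝓞 K) K |>.restrictScalars ℤ)

theorem mem_integers {x : K} : x ∈ integers K ↔ ∃ y : 𝓞 K, (y : K) = x := Iff.rfl

theorem integers_fg : (integers K).FG := by
  rw [integers, LinearMap.range_eq_map]
  exact (Module.Finite.fg_top (R := ℤ) (M := 𝓞 K)).map _

theorem clearsDenominators_integers : ClearsDenominators (integers K) := by
  intro x
  obtain ⟨d, hd, h⟩ := ((IsFractionRing.isAlgebraic_iff ℤ ℚ K).2
    (Algebra.IsAlgebraic.isAlgebraic x)).exists_integral_multiple
  refine ⟨d.natAbs, Int.natAbs_pos.2 hd, ?_⟩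
  rw [mem_integers]
  have h' : IsIntegral ℤ (((d.natAbs : ℤ) : K) * x) := by
    rw [zsmul_eq_mul] at h
    rcases Int.natAbs_eq d with e | e
    · rwa [← e]
    · have := h.neg
      rw [e] at this
      push_cast at this ⊢
      simpa using this
  exact ⟨⟨_, h'⟩, by simp⟩

end Denominators

/-! ### Commensurability of the unit groups -/

section UnitGroups

variable {K : Type*} [Field K] [NumberField K]

variable (K) in
/-- The units of the ring of integers inside `Kˣ`. -/
noncomputable def unitHom : (𝓞 K)ˣ →* Kˣ := Units.map (algebraMap (𝓞 K) K).toMonoidHom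

@[simp]
theorem coe_unitHom (e : (𝓞 K)ˣ) : ((unitHom K e : Kˣ) : K) = (e : K) := rfl

/-- A positive power of all units is congruent to one modulo a given positive integer. -/
theorem exists_pow_sub_one_dvd {d : ℕ} (hd : 0 < d) :
    ∃ M : ℕ, 0 < M ∧ ∀ e : (𝓞 K)ˣ, ∃ y : 𝓞 K, ((e : 𝓞 K) ^ M - 1) = d * y := by
  let I : Ideal (𝓞 K) := Ideal.span {(d : 𝓞 K)}
  have hI : I ≠ ⊥ := by
    simp [I, hd.ne']
  have : Finite (𝓞 K ⧸ I) := Ideal.finiteQuotientOfFreeOfNeBot I hI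
  -- The exponent is the order of the unit group of the finite ring `𝓞 K / d`.
  refine ⟨Nat.card (𝓞 K ⧸ I)ˣ, Nat.card_pos, fun e => ?_⟩
  have h := pow_card_eq_one' (x := Units.map (Ideal.Quotient.mk I).toMonoidHom e)
  have h' : Ideal.Quotient.mk I ((e : 𝓞 K) ^ Nat.card (𝓞 K ⧸ I)ˣ - 1) = 0 := by
    have := congrArg (fun u : (𝓞 K ⧸ I)ˣ => (u : 𝓞 K ⧸ I)) h
    simp only [Units.val_pow_eq_pow_val, Units.coe_map, Units.val_one] at this
    rw [map_sub, map_pow, map_one, sub_eq_zero]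
    exact this
  rw [Ideal.Quotient.eq_zero_iff_mem, Ideal.mem_span_singleton] at h'
  exact h'

/-- Choose `d` with `d c 𝓞 K ⊆ B`, then an exponent that makes every unit congruent to one modulo
`d`. -/
theorem ClearsDenominators.exists_pow {B : Submodule ℤ K} (hB : ClearsDenominators B) (c : K) :
    ∃ M : ℕ, 0 < M ∧ ∀ e : (𝓞 K)ˣ, ((e : K) ^ M - 1) * c ∈ B := by
  obtain ⟨d, hd, h⟩ := hB.of_fg (fg_map_mul integers_fg c)
  obtain ⟨M, hM, h'⟩ := exists_pow_sub_one_dvd (K := K) hd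
  refine ⟨M, hM, fun e => ?_⟩
  obtain ⟨y, hy⟩ := h' e
  have := h _ (Submodule.mem_map_of_mem (f := LinearMap.mulLeft ℤ c) ⟨y, rfl⟩)
  have hy' := congrArg (algebraMap (𝓞 K) K) hy
  simp only [map_sub, map_pow, map_one, map_mul, map_natCast] at hy'
  rw [show ((e : K) ^ M - 1) = d * (y : K) from hy', mul_assoc, mul_comm (y : K)]
  exact this

theorem exists_pow_mem_unitGroup (a b : K) (L : Submodule ℤ K) [Submodule.IsLattice ℚ L] :
    ∃ M : ℕ, 0 < M ∧ ∀ e : (𝓞 K)ˣ, unitHom K e ^ M ∈ unitGroup a b L := by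
  have hL := clearsDenominators_of_isLattice L
  have hL' : L.FG := Submodule.IsLattice.fg
  -- Each defining condition has its own exponent. The product serves all of them, since each
  -- condition may be applied to a power of `e`.
  obtain ⟨M₁, h₁, H₁⟩ := (hL.mult hL').exists_pow 1
  obtain ⟨M₂, h₂, H₂⟩ := hL.exists_pow a
  obtain ⟨M₃, h₃, H₃⟩ := (clearsDenominators_dual hL').exists_pow b
  obtain ⟨M₄, h₄, H₄⟩ := (clearsDenominators_dual (mult_fg hL hL')).exists_pow (a * b)
  have h1 : (1 : K) ∈ mult L := mem_mult.2 fun y hy => by simpa using hy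
  have key : ∀ e : (𝓞 K)ˣ, (e : K) ^ (M₁ * M₂ * M₃ * M₄) ∈ mult L := by
    intro e
    have := add_mem (H₁ (e ^ (M₂ * M₃ * M₄))) h1
    rw [mul_one, sub_add_cancel, Units.coe_pow, ← pow_mul] at this
    convert this using 2
    ring
  refine ⟨M₁ * M₂ * M₃ * M₄, by positivity, fun e => ⟨⟨?_, ?_⟩, ?_, ?_, ?_⟩⟩
  · simpa using key e
  · have := key e⁻¹
    rw [← inv_pow, ← map_inv]
    simpa using this
  · have := H₂ (e ^ (M₁ * M₃ * M₄))
    rw [Units.coe_pow, ← pow_mul] at this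
    rw [Units.val_pow_eq_pow_val, coe_unitHom]
    convert this using 4
    ring
  · have := H₃ (e ^ (M₁ * M₂ * M₄))
    rw [Units.coe_pow, ← pow_mul] at this
    rw [Units.val_pow_eq_pow_val, coe_unitHom]
    convert this using 4
    ring
  · have := H₄ (e ^ (M₁ * M₂ * M₃))
    rw [Units.coe_pow, ← pow_mul] at this
    rw [Units.val_pow_eq_pow_val, coe_unitHom]
    exact this

theorem exists_pow_mem_unitGroupPos (m n : Submodule ℤ K) [Submodule.IsLattice ℚ m]
    [Submodule.IsLattice ℚ n] (U : Matrix (Fin 2) (Fin 2) K) :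
    ∃ M : ℕ, 0 < M ∧ ∀ e : (𝓞 K)ˣ, unitHom K e ^ M ∈ unitGroupPos m n U := by
  obtain ⟨M₁, h₁, H₁⟩ := exists_pow_mem_unitGroup (U 0 1) (U 0 0) m
  obtain ⟨M₂, h₂, H₂⟩ := exists_pow_mem_unitGroup (U 1 1) (U 1 0) n
  -- The factor 2 makes the power a square, hence totally positive.
  refine ⟨M₁ * M₂ * 2, by positivity, fun e => ⟨⟨?_, ?_⟩, ?_⟩⟩
  · change unitHom K e ^ (M₁ * M₂ * 2) ∈ unitGroup _ _ _
    have := H₁ (e ^ (M₂ * 2))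
    rw [map_pow, ← pow_mul] at this
    convert this using 2
    ring
  · change unitHom K e ^ (M₁ * M₂ * 2) ∈ unitGroup _ _ _
    have := H₂ (e ^ (M₁ * 2))
    rw [map_pow, ← pow_mul] at this
    convert this using 2
    ring
  · intro σ
    rw [pow_mul, Units.val_pow_eq_pow_val, map_pow, sq_pos_iff]
    simp

/-- An element that maps a nonzero finitely generated module into itself is integral; this applies
to `e` and to its inverse. -/
theorem exists_unitHom_eq {e : Kˣ} {m : Submodule ℤ K} [Submodule.IsLattice ℚ m]
    (he : (e : K) ∈ mult m) (he' : ((e⁻¹ : Kˣ) : K) ∈ mult m) : ∃ f, unitHom K f = e := by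
  obtain ⟨y, hy, hy0⟩ := exists_ne_zero_mem (clearsDenominators_of_isLattice m)
  have hm : m ≠ ⊥ := fun h => hy0 (by simpa [h] using hy)
  have key : ∀ x ∈ mult m, IsIntegral ℤ x := fun x hx =>
    isIntegral_of_smul_mem_submodule m hm Submodule.IsLattice.fg x (mem_mult.1 hx)
  refine ⟨⟨⟨e, key _ he⟩, ⟨_, key _ he'⟩, ?_, ?_⟩, ?_⟩
  · exact RingOfIntegers.ext e.mul_inv
  · exact RingOfIntegers.ext e.inv_mul
  · ext; rfl

theorem unitGroupPos_le_range (m n : Submodule ℤ K) [Submodule.IsLattice ℚ m]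
    (U : Matrix (Fin 2) (Fin 2) K) : unitGroupPos m n U ≤ (unitHom K).range := by
  rintro e ⟨⟨⟨⟨h, h'⟩, -⟩, -⟩, -⟩
  exact exists_unitHom_eq h h'

theorem pos_of_mem_unitGroupPos {m n : Submodule ℤ K} {U : Matrix (Fin 2) (Fin 2) K} {e : Kˣ}
    (he : e ∈ unitGroupPos m n U) (σ : K →+* ℝ) : 0 < σ (e : K) :=
  he.2 σ

theorem sum_log_of_mem_unitGroupPos [IsTotallyReal K] {m n : Submodule ℤ K}
    [Submodule.IsLattice ℚ m] {U : Matrix (Fin 2) (Fin 2) K} {e : Kˣ}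
    (he : e ∈ unitGroupPos m n U) : ∑ σ : K →+* ℝ, Real.log (σ (e : K)) = 0 := by
  obtain ⟨f, rfl⟩ := unitGroupPos_le_range m n U he
  rw [← sum_log_abs_unit f]
  refine Finset.sum_congr rfl fun σ _ => ?_
  rw [Real.log_abs, coe_unitHom]

/-- The units of `𝓞 K` form a finitely generated abelian group, in which the `M`-th powers have
finite index; one group lies inside the units, the other contains those powers. As `relIndex` is
zero for an infinite index, positivity expresses finiteness. -/
theorem unitIndex_pos (m n : Submodule ℤ K) [Submodule.IsLattice ℚ m]
    (U : Matrix (Fin 2) (Fin 2) K) (m' n' : Submodule ℤ K)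
    [Submodule.IsLattice ℚ m'] [Submodule.IsLattice ℚ n'] (U' : Matrix (Fin 2) (Fin 2) K) :
    0 < unitIndex m n U m' n' U' := by
  obtain ⟨M, hM, h⟩ := exists_pow_mem_unitGroupPos m' n' U'
  have : Group.FG (𝓞 K)ˣ := Group.fg_iff_monoid_fg.2 inferInstance
  have hfg : (unitHom K).range.FG := (Group.fg_iff_subgroup_fg _).1 inferInstance
  have h1 := (Subgroup.isFiniteRelIndex_map_powMonoidHom_of_fg hfg hM.ne').relIndex_ne_zero
  have h2 : (unitHom K).range.map (powMonoidHom M) ≤ unitGroupPos m' n' U' := by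
    rintro _ ⟨_, ⟨e, rfl⟩, rfl⟩
    exact h e
  have h3 := mt (Subgroup.relIndex_eq_zero_of_le_left h2) h1
  exact Nat.pos_of_ne_zero
    (mt (Subgroup.relIndex_eq_zero_of_le_right (unitGroupPos_le_range m n U)) h3)

end UnitGroups

/-! ### Discreteness of the matrix groups -/

section Discreteness

variable {K : Type*} [Field K] [NumberField K]

/-- Suitable positive integers `a`, `b` give rows `(a, 0)` and `(0, b)` in the lattice. Their images
are multiples of the rows of `γ` with entries in `m ⊔ n`, whose denominators are bounded. -/
theorem exists_denominator_latticeGL (m n : Submodule ℤ K) [Submodule.IsLattice ℚ m]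
    [Submodule.IsLattice ℚ n] : ∃ d : ℕ, 0 < d ∧ ∀ γ ∈ latticeGL m n, ∀ i j,
      (d : K) * (γ : Matrix (Fin 2) (Fin 2) K) i j ∈ integers K := by
  obtain ⟨a, ha, hm⟩ := clearsDenominators_of_isLattice m 1
  obtain ⟨b, hb, hn⟩ := clearsDenominators_of_isLattice n 1
  have hfg : (m ⊔ n).FG :=
    (Submodule.IsLattice.fg (M := m)).sup (Submodule.IsLattice.fg (M := n))
  obtain ⟨d, hd, h⟩ := clearsDenominators_integers.of_fg hfg
  rw [mul_one] at hm hn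
  refine ⟨d * (a * b), by positivity, fun γ hγ i j => ?_⟩
  have hγ' : rowMul (dirSum m n) γ = dirSum m n := hγ
  have hrow : ∀ r ∈ dirSum m n, ∀ j, (r ᵥ* (γ : Matrix (Fin 2) (Fin 2) K)) j ∈ m ⊔ n := by
    intro r hr j
    have : r ᵥ* (γ : Matrix (Fin 2) (Fin 2) K) ∈ dirSum m n := by
      rw [← hγ']
      exact mem_rowMul.2 ⟨r, hr, rfl⟩
    fin_cases j
    · exact Submodule.mem_sup_left this.1
    · exact Submodule.mem_sup_right this.2
  push_cast
  rw [mul_assoc]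
  refine h _ ?_
  fin_cases i
  · have := natCast_mul_mem b (hrow ![(a : K), 0] ⟨by simpa using hm, by simp⟩ j)
    convert this using 1
    simp [Matrix.vecMul, dotProduct, Fin.sum_univ_two]
    ring
  · have := natCast_mul_mem a (hrow ![0, (b : K)] ⟨by simp, by simpa using hn⟩ j)
    convert this using 1
    simp [Matrix.vecMul, dotProduct, Fin.sum_univ_two]
    ring

theorem discreteTopology_map_of_le_latticeGL [IsTotallyReal K] (m n : Submodule ℤ K)
    [Submodule.IsLattice ℚ m] [Submodule.IsLattice ℚ n] {Γ : Subgroup (GL (Fin 2) K)}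
    (hΓ : Γ ≤ latticeGL m n) : DiscreteTopology (Γ.map (toGR K)) := by
  obtain ⟨d, hd, h⟩ := exists_denominator_latticeGL m n
  have hd' : (0 : ℝ) < d := by exact_mod_cast hd
  apply discreteTopology_of_isOpen_singleton_one
  -- With radius `1 / d` the entries of `d (γ - 1)` are integers all of whose conjugates are below
  -- one, hence zero.
  let V : Set (Γ.map (toGR K)) := {g | ∀ σ : K →+* ℝ, ∀ i j,
    |((g : GR K) σ : Matrix (Fin 2) (Fin 2) ℝ) i j - (1 : Matrix (Fin 2) (Fin 2) ℝ) i j| < 1 / d}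
  have hV : IsOpen V := by
    simp only [V, Set.ofPred_forall]
    refine isOpen_iInter_of_finite fun σ => isOpen_iInter_of_finite fun i =>
      isOpen_iInter_of_finite fun j => ?_
    refine isOpen_lt (Continuous.abs (Continuous.sub ?_ continuous_const)) continuous_const
    exact ((Units.continuous_val.comp ((continuous_apply σ).comp continuous_subtype_val)).matrix_elem
      i j)
  convert hV
  ext ⟨g, γ, hγ, rfl⟩
  simp only [Set.mem_singleton_iff, V, Set.mem_ofPred_eq]
  constructor
  · intro e σ i j
    have e' : toGR K γ = 1 := congrArg Subtype.val e
    rw [e']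
    simp [hd]
  · intro H
    have key : γ = 1 := by
      refine Units.ext (Matrix.ext fun i j => ?_)
      obtain ⟨y, hy⟩ := mem_integers.1 (h γ (hΓ hγ) i j)
      obtain ⟨y', hy'⟩ := mem_integers.1 (h 1 (one_mem _) i j)
      have : y - y' = 0 := by
        refine eq_zero_of_forall_abs_lt_one fun σ => ?_
        have h1 := H σ i j
        have h2 : σ ((1 : Matrix (Fin 2) (Fin 2) K) i j) = (1 : Matrix (Fin 2) (Fin 2) ℝ) i j := by
          simp [Matrix.one_apply, apply_ite σ]
        rw [toGR_apply, ← h2, ← map_sub, lt_div_iff₀ hd'] at h1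
        have h3 : ((y - y' : 𝓞 K) : K) = (d : K) *
            ((γ : Matrix (Fin 2) (Fin 2) K) i j - (1 : Matrix (Fin 2) (Fin 2) K) i j) := by
          exact (map_sub (algebraMap (𝓞 K) K) y y').trans
            ((congrArg₂ (· - ·) hy hy').trans (mul_sub _ _ _).symm)
        rw [h3, map_mul, map_natCast, abs_mul, abs_of_pos hd', mul_comm]
        exact h1
      have h4 : (y : K) = y' := by rw [sub_eq_zero.1 this]
      rw [hy, hy'] at h4
      exact mul_left_cancel₀ (by exact_mod_cast hd.ne') h4
    exact Subtype.ext (by simp [key])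

end Discreteness

/-! ### The lattice sum over pairs of integers -/

section LatticeSum

variable (K : Type*) [Field K] [NumberField K]

/-- The embedding of `𝓞 K × 𝓞 K` in `(ℝ × ℝ)^g`. -/
noncomputable def pairEmb : (𝓞 K × 𝓞 K) →ₗ[ℤ] ((K →+* ℝ) → ℝ × ℝ) :=
  AddMonoidHom.toIntLinearMap
    { toFun := fun x σ => (σ (x.1 : K), σ (x.2 : K))
      map_zero' := by ext <;> simp
      map_add' := fun x y => by ext <;> simp }

variable {K}

variable [IsTotallyReal K]

theorem pairEmb_eq_zero_of_norm_lt_one {x : 𝓞 K × 𝓞 K} (h : ‖pairEmb K x‖ < 1) : x = 0 := by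
  rw [pi_norm_lt_iff one_pos] at h
  refine Prod.ext (eq_zero_of_forall_abs_lt_one fun σ => ?_)
    (eq_zero_of_forall_abs_lt_one fun σ => ?_)
  · exact lt_of_le_of_lt (norm_fst_le (pairEmb K x σ)) (h σ)
  · exact lt_of_le_of_lt (norm_snd_le (pairEmb K x σ)) (h σ)

theorem pairEmb_injective : Function.Injective (pairEmb K) := by
  rw [← LinearMap.ker_eq_bot, LinearMap.ker_eq_bot']
  intro x hx
  exact pairEmb_eq_zero_of_norm_lt_one (by simp [hx])

instance discreteTopology_range_pairEmb :
    DiscreteTopology (LinearMap.range (pairEmb K)) := by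
  apply discreteTopology_of_isOpen_singleton_zero
  have h : ({0} : Set (LinearMap.range (pairEmb K))) = Metric.ball 0 1 := by
    refine Set.Subset.antisymm ?_ ?_
    · rintro _ rfl
      exact Metric.mem_ball_self one_pos
    · rintro ⟨_, x, rfl⟩ h
      have h' : ‖pairEmb K x‖ < 1 := mem_ball_zero_iff.1 h
      exact Subtype.ext (by simp [pairEmb_eq_zero_of_norm_lt_one h'])
  rw [h]
  exact Metric.isOpen_ball

theorem summable_norm_pairEmb {r : ℝ} (hr : 2 * (Fintype.card (K →+* ℝ) : ℝ) < r) :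
    Summable fun x : 𝓞 K × 𝓞 K => ‖pairEmb K x‖ ^ (-r) := by
  let e := LinearEquiv.ofInjective _ (pairEmb_injective (K := K))
  have hfin : Module.finrank ℤ (LinearMap.range (pairEmb K)) = 2 * Fintype.card (K →+* ℝ) := by
    rw [← e.finrank_eq, Module.finrank_prod, RingOfIntegers.rank, card_embeddings, two_mul]
  have h := ZLattice.summable_norm_rpow (LinearMap.range (pairEmb K)) (-r) (by
    rw [hfin]; push_cast; linarith)
  exact (e.toEquiv.summable_iff.2 h).congr fun _ => rfl

end LatticeSum

/-! ### Balancing local heights by units -/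

section Balancing

variable {K : Type*} [Field K] [NumberField K] [IsTotallyReal K]

open Units Units.dirichletUnitTheorem in
variable (K) in
/-- A consequence of Dirichlet's unit theorem: the logarithmic unit lattice is cobounded in the
hyperplane of vectors of trace zero. -/
theorem exists_unit_log_le : ∃ C : ℝ, 0 ≤ C ∧ ∀ t : (K →+* ℝ) → ℝ, ∑ σ, t σ = 0 →
    ∃ e : (𝓞 K)ˣ, ∀ σ, |t σ + Real.log (|σ (e : K)|)| ≤ C := by
  classical
  let b := (basisUnitLattice K).ofZLatticeBasis ℝ (unitLattice K)
  let C₀ : ℝ := ∑ i, ‖b i‖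
  have hC₀ : 0 ≤ C₀ := Finset.sum_nonneg fun _ _ => norm_nonneg _
  let E := realPlaceEquiv K
  -- `C₀` bounds the fractional part of a vector with respect to a basis of the unit lattice, that
  -- is, the coordinates away from the omitted place `w₀`. The second summand pays for `w₀`.
  refine ⟨C₀ + Fintype.card (K →+* ℝ) * C₀, by positivity, fun t ht => ?_⟩
  let v : logSpace K := fun u => -t (E.symm u.1)
  have hmem : ((ZSpan.floor b v : Submodule.span ℤ (Set.range b)) : logSpace K) ∈
      unitLattice K := by
    have := (ZSpan.floor b v).2
    exact (Module.Basis.ofZLatticeBasis_span ℝ (unitLattice K) (basisUnitLattice K)).le this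
  obtain ⟨e, -, he⟩ := hmem
  refine ⟨e.toMul, ?_⟩
  let f : (K →+* ℝ) → ℝ := fun σ => t σ + Real.log (|σ ((e.toMul : (𝓞 K)ˣ) : K)|)
  have hf : ∑ σ, f σ = 0 := by
    simp only [f, Finset.sum_add_distrib, ht, sum_log_abs_unit, add_zero]
  have h1 : ∀ σ, E σ ≠ w₀ → |f σ| ≤ C₀ := by
    intro σ hσ
    have h2 := ZSpan.norm_fract_le (K := ℝ) b v
    have h3 := (norm_le_pi_norm (ZSpan.fract b v) ⟨E σ, hσ⟩).trans h2
    have h4 : (logEmbedding K e) ⟨E σ, hσ⟩ = Real.log (|σ ((e.toMul : (𝓞 K)ˣ) : K)|) := by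
      rw [← realPlaceEquiv_apply]
      refine (logEmbedding_component (e.toMul) ⟨E σ, hσ⟩).trans ?_
      rw [IsTotallyReal.mult_eq, Nat.cast_one, one_mul]
    have h5 : ZSpan.fract b v ⟨E σ, hσ⟩ = -f σ := by
      rw [ZSpan.fract_apply, ← he]
      change v ⟨E σ, hσ⟩ - (logEmbedding K e) ⟨E σ, hσ⟩ = -f σ
      rw [h4]
      simp only [v, f, Equiv.symm_apply_apply]
      ring
    rwa [h5, norm_neg, Real.norm_eq_abs] at h3
  intro σ
  change |f σ| ≤ _
  by_cases hσ : E σ = w₀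
  · have h2 : f σ = -∑ τ ∈ Finset.univ.erase σ, f τ := by
      rw [← Finset.add_sum_erase _ _ (Finset.mem_univ σ)] at hf
      linarith
    have h3 : |f σ| ≤ ∑ τ ∈ Finset.univ.erase σ, C₀ := by
      rw [h2, abs_neg]
      refine (Finset.abs_sum_le_sum_abs _ _).trans (Finset.sum_le_sum fun τ hτ => h1 τ ?_)
      intro h
      exact (Finset.mem_erase.1 hτ).1 (E.injective (h.trans hσ.symm))
    have h4 : ∑ τ ∈ Finset.univ.erase σ, C₀ ≤ ∑ τ : K →+* ℝ, C₀ :=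
      Finset.sum_le_sum_of_subset_of_nonneg (Finset.erase_subset _ _) fun _ _ _ => hC₀
    rw [Finset.sum_const _ (s := Finset.univ), Finset.card_univ, nsmul_eq_mul] at h4
    linarith
  · have := h1 σ hσ
    have : 0 ≤ Fintype.card (K →+* ℝ) * C₀ := by positivity
    linarith

/-- The local height of a pair at a real embedding. -/
noncomputable def height (x : K × K) (σ : K →+* ℝ) : ℝ := max |σ x.1| |σ x.2|

theorem height_pos {x : K × K} (hx : x ≠ 0) (σ : K →+* ℝ) : 0 < height x σ := by
  rw [height, lt_max_iff, abs_pos, abs_pos, map_ne_zero, map_ne_zero]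
  by_contra h
  simp only [not_or, not_not] at h
  exact hx (Prod.ext h.1 h.2)

theorem height_mul (c : K) (x : K × K) (σ : K →+* ℝ) :
    height (c * x.1, c * x.2) σ = |σ c| * height x σ := by
  simp only [height, map_mul, abs_mul]
  rw [mul_max_of_nonneg _ _ (abs_nonneg _)]

theorem norm_pairEmb_le {x : 𝓞 K × 𝓞 K} {c : ℝ}
    (h : ∀ σ, height ((x.1 : K), (x.2 : K)) σ ≤ c) : ‖pairEmb K x‖ ≤ c := by
  obtain ⟨σ₀⟩ := nonempty_embeddings (K := K)
  refine (pi_norm_le_iff_of_nonneg ?_).2 h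
  exact le_trans (le_max_of_le_left (abs_nonneg _)) (h σ₀)

/-- Multiplication by a suitable element of the unit group makes all local heights comparable. -/
theorem exists_balancing_unit (m n : Submodule ℤ K) [Submodule.IsLattice ℚ m]
    [Submodule.IsLattice ℚ n] (U : Matrix (Fin 2) (Fin 2) K) :
    ∃ C : ℝ, ∀ x : K × K, x ≠ 0 → ∃ f : (𝓞 K)ˣ, unitHom K f ∈ unitGroupPos m n U ∧
      ∀ σ, Real.log (height ((f : K) * x.1, (f : K) * x.2) σ) ≤
        C + (∑ τ, Real.log (height x τ)) / Fintype.card (K →+* ℝ) := by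
  obtain ⟨M, hM, hM'⟩ := exists_pow_mem_unitGroupPos m n U
  obtain ⟨C, -, hC⟩ := exists_unit_log_le K
  have hg : (Fintype.card (K →+* ℝ) : ℝ) ≠ 0 := by exact_mod_cast Fintype.card_ne_zero
  have hMr : (0 : ℝ) < M := by exact_mod_cast hM
  refine ⟨M * C, fun x hx => ?_⟩
  set T : ℝ := (∑ τ, Real.log (height x τ)) / Fintype.card (K →+* ℝ) with hT
  -- The deviations of the logarithmic heights from their mean sum to zero. They are divided by `M`
  -- because only the `M`-th power of the unit is known to lie in the group.
  obtain ⟨e, he⟩ := hC (fun σ => (Real.log (height x σ) - T) / M) (by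
    rw [← Finset.sum_div, Finset.sum_sub_distrib, Finset.sum_const, Finset.card_univ,
      nsmul_eq_mul, hT, mul_div_cancel₀ _ hg, sub_self, zero_div])
  refine ⟨e ^ M, by rw [map_pow]; exact hM' e, fun σ => ?_⟩
  have h1 := (abs_le.1 (he σ)).2
  have h2 : |σ (e : K)| ≠ 0 := by simp
  rw [height_mul, Units.coe_pow, map_pow, abs_pow,
    Real.log_mul (pow_ne_zero _ h2) (height_pos hx σ).ne', Real.log_pow]
  have h3 := mul_le_mul_of_nonneg_left h1 hMr.le
  rw [mul_add, mul_div_cancel₀ _ hMr.ne'] at h3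
  linarith

theorem prod_height_rpow {x : K × K} (hx : x ≠ 0) (k : ℝ) :
    ∏ σ, height x σ ^ k = Real.exp (k * ∑ σ, Real.log (height x σ)) := by
  rw [Finset.mul_sum, Real.exp_sum]
  refine Finset.prod_congr rfl fun σ _ => ?_
  rw [Real.rpow_def_of_pos (height_pos hx σ), mul_comm]

/-- A balanced representative, multiplied by a common denominator `d`, is a pair `y` of integers
with `‖y‖` at most a constant times `exp (S / g)`, where `S` is the sum of the logarithmic heights.
Hence `exp (-k S)` is bounded by a constant times `‖y‖ ^ (-k g)`, and `k g > 2 g` suffices in rank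
`2g`. -/
theorem summable_prod_height (m n : Submodule ℤ K) [Submodule.IsLattice ℚ m]
    [Submodule.IsLattice ℚ n] (U : Matrix (Fin 2) (Fin 2) K) {k : ℝ} (hk : 2 < k) :
    Summable fun q : Orbits m n U => ∏ σ, height (Quotient.out q).1 σ ^ (-k) := by
  obtain ⟨C, hC⟩ := exists_balancing_unit m n U
  have hfg : ((m ⊔ n) ⊔ (Submodule.span ℤ {U 0 1} ⊔ Submodule.span ℤ {U 1 1})).FG :=
    ((Submodule.IsLattice.fg (M := m)).sup (Submodule.IsLattice.fg (M := n))).sup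
      ((Submodule.fg_span_singleton _).sup (Submodule.fg_span_singleton _))
  obtain ⟨d, hd, hd'⟩ := clearsDenominators_integers.of_fg hfg
  have hd0 : (0 : ℝ) < d := by exact_mod_cast hd
  choose f hf hf' using fun q : Orbits m n U => hC (Quotient.out q).1 (Quotient.out q).2.2
  have hint : ∀ q : Orbits m n U, ∃ y : 𝓞 K × 𝓞 K,
      (y.1 : K) = d * ((f q : K) * (Quotient.out q).1.1) ∧
      (y.2 : K) = d * ((f q : K) * (Quotient.out q).1.2) := by
    intro q
    obtain ⟨⟨h1, h2⟩, -⟩ := (Quotient.out q).2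
    have h1' : (Quotient.out q).1.1 ∈
        (m ⊔ n) ⊔ (Submodule.span ℤ {U 0 1} ⊔ Submodule.span ℤ {U 1 1}) := by
      rw [← sub_add_cancel (Quotient.out q).1.1 (U 0 1)]
      exact add_mem (Submodule.mem_sup_left (Submodule.mem_sup_left h1))
        (Submodule.mem_sup_right (Submodule.mem_sup_left (Submodule.mem_span_singleton_self _)))
    have h2' : (Quotient.out q).1.2 ∈
        (m ⊔ n) ⊔ (Submodule.span ℤ {U 0 1} ⊔ Submodule.span ℤ {U 1 1}) := by
      rw [← sub_add_cancel (Quotient.out q).1.2 (U 1 1)]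
      exact add_mem (Submodule.mem_sup_left (Submodule.mem_sup_right h2))
        (Submodule.mem_sup_right (Submodule.mem_sup_right (Submodule.mem_span_singleton_self _)))
    obtain ⟨y1, hy1⟩ := mem_integers.1 (hd' _ h1')
    obtain ⟨y2, hy2⟩ := mem_integers.1 (hd' _ h2')
    refine ⟨(f q * y1, f q * y2), ?_, ?_⟩
    · rw [mul_left_comm, ← hy1]
      exact map_mul (algebraMap (𝓞 K) K) _ _
    · rw [mul_left_comm, ← hy2]
      exact map_mul (algebraMap (𝓞 K) K) _ _
  choose y hy1 hy2 using hint
  have hdK : (d : K) ≠ 0 := by exact_mod_cast hd.ne'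
  -- The balancing units belong to the acting group, so equal pairs come from the same orbit.
  have hinj : Function.Injective y := by
    intro q q' h
    have e1 : (f q : K) * (Quotient.out q).1.1 = (f q' : K) * (Quotient.out q').1.1 :=
      mul_left_cancel₀ hdK (by rw [← hy1, ← hy1, h])
    have e2 : (f q : K) * (Quotient.out q).1.2 = (f q' : K) * (Quotient.out q').1.2 :=
      mul_left_cancel₀ hdK (by rw [← hy2, ← hy2, h])
    rw [← Quotient.out_eq q, ← Quotient.out_eq q']
    refine Quotient.sound ⟨(unitHom K (f q'))⁻¹ * unitHom K (f q),
      mul_mem (inv_mem (hf q')) (hf q), ?_, ?_⟩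
    · rw [Units.val_mul, mul_assoc, coe_unitHom, e1, ← coe_unitHom, Units.inv_mul_cancel_left]
    · rw [Units.val_mul, mul_assoc, coe_unitHom, e2, ← coe_unitHom, Units.inv_mul_cancel_left]
  set g : ℝ := (Fintype.card (K →+* ℝ) : ℝ) with hg
  have hg0 : 0 < g := by
    rw [hg]
    exact_mod_cast Fintype.card_pos
  have hsum := (summable_norm_pairEmb (K := K) (r := k * g)
    (by nlinarith)).comp_injective hinj
  refine Summable.of_nonneg_of_le (fun q => Finset.prod_nonneg fun σ _ =>
    Real.rpow_nonneg (height_pos (Quotient.out q).2.2 σ).le _) (fun q => ?_)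
    (hsum.mul_left (Real.exp (k * g * (C + Real.log d))))
  have hx := (Quotient.out q).2.2
  set x := (Quotient.out q).1 with hxdef
  set S : ℝ := ∑ τ, Real.log (height x τ) with hS
  have hy0 : y q ≠ 0 := by
    intro h
    apply hx
    have h1 := hy1 q
    have h2 := hy2 q
    rw [h] at h1 h2
    have hfq : (f q : K) ≠ 0 := Units.coe_ne_zero _
    simp only [Prod.fst_zero, Prod.snd_zero, map_zero, zero_eq_mul, hdK, false_or] at h1 h2
    exact Prod.ext ((mul_eq_zero.1 h1).resolve_left hfq) ((mul_eq_zero.1 h2).resolve_left hfq)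
  have hpos : 0 < ‖pairEmb K (y q)‖ := by
    rw [norm_pos_iff]
    exact fun h => hy0 (pairEmb_injective (h.trans (map_zero _).symm))
  have hle : ‖pairEmb K (y q)‖ ≤ Real.exp (Real.log d + (C + S / g)) := by
    refine norm_pairEmb_le fun σ => ?_
    have hfx : ((f q : K) * x.1, (f q : K) * x.2) ≠ 0 := by
      intro h
      have hfq : (f q : K) ≠ 0 := Units.coe_ne_zero _
      simp only [Prod.mk_eq_zero, mul_eq_zero, hfq, false_or] at h
      exact hx (Prod.ext h.1 h.2)
    have h1 := hf' q σ
    rw [Real.log_le_iff_le_exp (height_pos hfx σ)] at h1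
    rw [hy1, hy2, Real.exp_add, Real.exp_log hd0]
    rw [height_mul (d : K) ((f q : K) * x.1, (f q : K) * x.2), map_natCast, abs_of_pos hd0]
    exact mul_le_mul_of_nonneg_left h1 hd0.le
  rw [prod_height_rpow hx, Function.comp_apply]
  have h2 : Real.exp (Real.log d + (C + S / g)) ^ (-(k * g)) ≤ ‖pairEmb K (y q)‖ ^ (-(k * g)) :=
    Real.rpow_le_rpow_of_nonpos hpos hle (by nlinarith)
  refine le_trans (le_of_eq ?_) (mul_le_mul_of_nonneg_left h2 (Real.exp_pos _).le)
  rw [← Real.exp_mul, ← Real.exp_add]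
  congr 1
  field_simp
  ring

end Balancing

/-! ### Absolute convergence and continuity -/

section Convergence

variable {K : Type*} [Field K] [NumberField K] [IsTotallyReal K]

/-- The imaginary part of `az + b` is `a y`, which bounds `a`; then `b` is recovered by subtracting
`az`. -/
theorem height_le_norm_linear_form {z : (K →+* ℝ) → ℂ} (hz : z ∈ KCpm K) (x : K × K)
    (σ : K →+* ℝ) : height x σ ≤ (1 + 2 * ‖z σ‖) / |(z σ).im| *
      ‖((σ x.1 : ℝ) : ℂ) * z σ + ((σ x.2 : ℝ) : ℂ)‖ := by
  have hy : 0 < |(z σ).im| := abs_pos.2 (hz σ)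
  set l := ((σ x.1 : ℝ) : ℂ) * z σ + ((σ x.2 : ℝ) : ℂ) with hl
  have h1 : |σ x.1| * |(z σ).im| ≤ ‖l‖ := by
    have := Complex.abs_im_le_norm l
    rw [hl, Complex.add_im, Complex.im_ofReal_mul, Complex.ofReal_im, add_zero, abs_mul] at this
    exact this
  have h2 : |σ x.2| ≤ ‖l‖ + |σ x.1| * ‖z σ‖ := by
    have e : ((σ x.2 : ℝ) : ℂ) = l - ((σ x.1 : ℝ) : ℂ) * z σ := by rw [hl]; ring
    have := norm_sub_le l (((σ x.1 : ℝ) : ℂ) * z σ)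
    rwa [← e, norm_mul, Complex.norm_real, Complex.norm_real, Real.norm_eq_abs,
      Real.norm_eq_abs] at this
  have h3 : |(z σ).im| ≤ ‖z σ‖ := Complex.abs_im_le_norm _
  have h4 := norm_nonneg l
  have h5 := norm_nonneg (z σ)
  rw [div_mul_eq_mul_div, height, max_le_iff, le_div_iff₀ hy, le_div_iff₀ hy]
  constructor
  · nlinarith
  · have := mul_le_mul_of_nonneg_right h2 hy.le
    have := mul_le_mul_of_nonneg_right h1 h5
    nlinarith

/-- The locally bounded factor in the majorant of the series. -/
noncomputable def majorantFactor (w : ℤ) (s : ℂ) (z : (K →+* ℝ) → ℂ) : ℝ :=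
  ∏ σ, (|(z σ).im| ^ s.re * ((1 + 2 * ‖z σ‖) / |(z σ).im|) ^ (2 * s.re + w))

theorem continuousOn_majorantFactor (w : ℤ) (s : ℂ) :
    ContinuousOn (majorantFactor w s) (KCpm K) := by
  refine continuousOn_finsetProd _ fun σ _ => ContinuousOn.mul ?_ ?_
  · refine ContinuousOn.rpow_const (by fun_prop) fun z hz => Or.inl (abs_ne_zero.2 (hz σ))
  · refine ContinuousOn.rpow_const (ContinuousOn.div (by fun_prop) (by fun_prop)
      fun z hz => abs_ne_zero.2 (hz σ)) fun z hz => Or.inl (div_ne_zero ?_ (abs_ne_zero.2 (hz σ)))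
    positivity

/-- The bound separates a factor in `z` from a factor in the pair. This gives convergence and, since
the first factor is continuous, local uniformity. -/
theorem norm_eisTerm_le (U : Matrix (Fin 2) (Fin 2) K) (p : (K →+* ℝ) → ℤ) {w : ℤ} {s : ℂ}
    (hs : 1 - (w : ℝ) / 2 < s.re) {z : (K →+* ℝ) → ℂ} (hz : z ∈ KCpm K) {x : K × K} (hx : x ≠ 0) :
    ‖eisTerm U p w z s x‖ ≤
      majorantFactor w s z * ∏ σ, height x σ ^ (-(2 * s.re + w)) := by
  have hk : 0 ≤ 2 * s.re + w := by linarith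
  rw [eisTerm, norm_div, norm_mul, norm_monomialP_wt p w s (linear_form_ne_zero hz hx)]
  have h1 : ‖Complex.exp (2 * Real.pi * Complex.I *
      ((Algebra.trace ℚ K (U 0 0 * x.1 + U 1 0 * x.2) : ℚ) : ℂ))‖ = 1 := by
    rw [Complex.norm_exp]
    simp
  rw [h1, one_mul, absPow, norm_prod, majorantFactor, ← Finset.prod_mul_distrib,
    ← Finset.prod_div_distrib]
  refine Finset.prod_le_prod (fun σ _ => by positivity) fun σ _ => ?_
  have hy : 0 < |(z σ).im| := abs_pos.2 (hz σ)
  have hl : 0 < ‖((σ x.1 : ℝ) : ℂ) * z σ + ((σ x.2 : ℝ) : ℂ)‖ :=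
    norm_pos_iff.2 (linear_form_ne_zero hz hx σ)
  have hh := height_pos hx σ
  have hB : 0 ≤ (1 + 2 * ‖z σ‖) / |(z σ).im| := by positivity
  rw [Complex.norm_cpow_eq_rpow_re_of_pos hy, mul_assoc, div_eq_mul_inv]
  refine mul_le_mul_of_nonneg_left ?_ (by positivity)
  rw [Real.rpow_neg hh.le, ← div_eq_mul_inv, le_div_iff₀ (by positivity), inv_mul_le_iff₀
    (by positivity), ← Real.mul_rpow hl.le hB]
  exact Real.rpow_le_rpow hh.le ((height_le_norm_linear_form hz x σ).trans_eq (mul_comm _ _)) hk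

theorem continuousOn_eisTerm (U : Matrix (Fin 2) (Fin 2) K) (p : (K →+* ℝ) → ℤ) (w : ℤ) (s : ℂ)
    {x : K × K} (hx : x ≠ 0) : ContinuousOn (fun z => eisTerm U p w z s x) (KCpm K) := by
  simp only [eisTerm]
  refine ContinuousOn.div (ContinuousOn.mul continuousOn_const ?_) ?_
    fun z _ => monomialP_ne_zero _ _ _
  · refine ContinuousOn.congr (f := fun z => ∏ σ : K →+* ℝ,
      Complex.exp (s * (Real.log |(z σ).im| : ℝ))) ?_ fun z hz => absPow_eq_exp hz _
    refine continuousOn_finsetProd _ fun σ _ => ?_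
    have : ContinuousOn (fun z : (K →+* ℝ) → ℂ => Real.log |(z σ).im|) (KCpm K) :=
      ContinuousOn.log (by fun_prop) fun z hz => abs_ne_zero.2 (hz σ)
    fun_prop
  · refine ContinuousOn.congr ?_ fun z hz =>
      monomialP_eq_prod (wt_sub p w s) (linear_form_ne_zero hz hx)
    refine continuousOn_finsetProd _ fun σ _ => ContinuousOn.mul ?_ ?_
    · have : ContinuousOn (fun z : (K →+* ℝ) → ℂ =>
          Real.log ‖((σ x.1 : ℝ) : ℂ) * z σ + ((σ x.2 : ℝ) : ℂ)‖) (KCpm K) :=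
        ContinuousOn.log (by fun_prop) fun z hz =>
          norm_ne_zero_iff.2 (linear_form_ne_zero hz hx σ)
      fun_prop
    · exact ContinuousOn.zpow₀ (by fun_prop) _ fun z hz => Or.inl (linear_form_ne_zero hz hx σ)

variable (m n : Submodule ℤ K) [Submodule.IsLattice ℚ m] [Submodule.IsLattice ℚ n]
  (U : Matrix (Fin 2) (Fin 2) K) (p : (K →+* ℝ) → ℤ) {w : ℤ} {s : ℂ}

theorem summable_norm_orbitTerm (hs : 1 - (w : ℝ) / 2 < s.re) {z : (K →+* ℝ) → ℂ}
    (hz : z ∈ KCpm K) : Summable fun q => ‖orbitTerm m n U p w z s q‖ :=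
  Summable.of_nonneg_of_le (fun _ => norm_nonneg _)
    (fun q => norm_eisTerm_le U p hs hz (Quotient.out q).2.2)
    ((summable_prod_height m n U (k := 2 * s.re + w) (by linarith)).mul_left _)

theorem continuousOn_eisSeries (hs : 1 - (w : ℝ) / 2 < s.re) :
    ContinuousOn (fun z => eisSeries m n U p w z s) (KCpm K) := by
  intro z₀ hz₀
  -- On this relative neighbourhood of `z₀` the factor in `z` is bounded by a constant, so the
  -- Weierstrass test applies.
  let S : Set ((K →+* ℝ) → ℂ) := {z | z ∈ KCpm K ∧ majorantFactor w s z < majorantFactor w s z₀ + 1}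
  have hS : S ∈ 𝓝[KCpm K] z₀ := by
    have := (continuousOn_majorantFactor (K := K) w s z₀ hz₀).eventually
      (gt_mem_nhds (lt_add_one (majorantFactor w s z₀)))
    filter_upwards [this, self_mem_nhdsWithin] with z h1 h2 using ⟨h2, h1⟩
  have hcont : ContinuousOn (fun z => eisSeries m n U p w z s) S := by
    refine continuousOn_tsum (fun q => (continuousOn_eisTerm U p w s
      (Quotient.out q).2.2).mono fun z hz => hz.1)
      ((summable_prod_height m n U (k := 2 * s.re + w) (by linarith)).mul_left
        (majorantFactor w s z₀ + 1)) fun q z hz => ?_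
    refine (norm_eisTerm_le U p hs hz.1 (Quotient.out q).2.2).trans
      (mul_le_mul_of_nonneg_right hz.2.le ?_)
    exact Finset.prod_nonneg fun σ _ =>
      Real.rpow_nonneg (height_pos (Quotient.out q).2.2 σ).le _
  exact (hcont z₀ ⟨hz₀, lt_add_one _⟩).mono_of_mem_nhdsWithin hS

theorem continuousOn_eisG (hs : 1 - (w : ℝ) / 2 < s.re) :
    ContinuousOn (eisG m n U p w s) (KCpm K) := by
  refine (continuousOn_eisSeries m n U p hs).congr fun z _ => ?_
  rw [eisG, if_pos hs]

end Convergence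

/-! ### Orbit sums over commensurable groups -/

section OrbitSums

variable {K : Type*} [Field K]

/-- The orbit relation of a group of scalars `W` on the pairs satisfying `P`. -/
def orbRel (W : Subgroup Kˣ) (P : K × K → Prop) : Setoid {x // P x} where
  r x y := ∃ e ∈ W, y.1.1 = (e : K) * x.1.1 ∧ y.1.2 = (e : K) * x.1.2
  iseqv :=
    { refl := fun x => ⟨1, one_mem _, by simp, by simp⟩
      symm := by
        rintro x y ⟨e, he, h1, h2⟩
        exact ⟨e⁻¹, inv_mem he, by rw [h1]; simp, by rw [h2]; simp⟩
      trans := by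
        rintro x y z ⟨e, he, h1, h2⟩ ⟨f, hf, g1, g2⟩
        exact ⟨f * e, mul_mem hf he, by rw [g1, h1]; simp [mul_assoc],
          by rw [g2, h2]; simp [mul_assoc]⟩ }

/-- The sum of `f` over representatives of the orbits of `W` on the pairs satisfying `P`. -/
noncomputable def orbSum (W : Subgroup Kˣ) (P : K × K → Prop) (f : K × K → ℂ) : ℂ :=
  ∑' q : Quotient (orbRel W P), f (Quotient.out q).1

/-- Absolute convergence of `orbSum`. -/
def OrbSummable (W : Subgroup Kˣ) (P : K × K → Prop) (f : K × K → ℂ) : Prop :=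
  Summable fun q : Quotient (orbRel W P) => ‖f (Quotient.out q).1‖

/-- `P` is stable under multiplication by `W`. -/
def IsStable (W : Subgroup Kˣ) (P : K × K → Prop) : Prop :=
  ∀ e ∈ W, ∀ x, P x → P ((e : K) * x.1, (e : K) * x.2)

/-- `f` is constant on the orbits of `W` on `P`. -/
def IsOrbInvariant (W : Subgroup Kˣ) (P : K × K → Prop) (f : K × K → ℂ) : Prop :=
  ∀ e ∈ W, ∀ x, P x → f ((e : K) * x.1, (e : K) * x.2) = f x

variable {W V : Subgroup Kˣ} {P Q : K × K → Prop} {f : K × K → ℂ}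

theorem IsOrbInvariant.out_mk (hf : IsOrbInvariant W P f) (x : {x // P x}) :
    f (Quotient.out (Quotient.mk (orbRel W P) x)).1 = f x.1 := by
  obtain ⟨e, he, h1, h2⟩ := (orbRel W P).symm (Quotient.mk_out (s := orbRel W P) x)
  rw [← hf e he _ x.2]
  exact congrArg f (Prod.ext h1 h2)

theorem orbSum_eq_const_mul {g : K × K → ℂ} {c : ℂ} (h : ∀ x, P x → g x = c * f x) :
    orbSum W P g = c * orbSum W P f := by
  rw [orbSum, orbSum, ← tsum_mul_left]
  exact tsum_congr fun q => h _ (Quotient.out q).2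

/-- Transport of orbits along a bijection commuting with scalars. -/
theorem exists_equiv_orbits (W : Subgroup Kˣ) (E : {x // P x} ≃ {x // Q x})
    (hE : ∀ x y : {x // P x}, ∀ e : Kˣ, (y.1.1 = (e : K) * x.1.1 ∧ y.1.2 = (e : K) * x.1.2) ↔
      ((E y).1.1 = (e : K) * (E x).1.1 ∧ (E y).1.2 = (e : K) * (E x).1.2)) :
    ∃ E' : Quotient (orbRel W P) ≃ Quotient (orbRel W Q),
      ∀ x, E' (Quotient.mk _ x) = Quotient.mk _ (E x) := by
  refine ⟨Quotient.congr E fun x y => ?_, fun x => rfl⟩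
  exact exists_congr fun e => and_congr_right fun _ => hE x y e

theorem orbSum_transport (E : {x // P x} ≃ {x // Q x})
    (hE : ∀ x y : {x // P x}, ∀ e : Kˣ, (y.1.1 = (e : K) * x.1.1 ∧ y.1.2 = (e : K) * x.1.2) ↔
      ((E y).1.1 = (e : K) * (E x).1.1 ∧ (E y).1.2 = (e : K) * (E x).1.2))
    {g : K × K → ℂ} (hg : IsOrbInvariant W Q g) (h : ∀ x : {x // P x}, f x.1 = g (E x).1) :
    orbSum W P f = orbSum W Q g ∧ (OrbSummable W P f ↔ OrbSummable W Q g) := by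
  obtain ⟨E', hE'⟩ := exists_equiv_orbits W E hE
  have key : ∀ q, f (Quotient.out q).1 = g (Quotient.out (E' q)).1 := by
    intro q
    conv_rhs => rw [← Quotient.out_eq q]
    rw [hE', hg.out_mk, h]
  constructor
  · rw [orbSum, orbSum, ← E'.tsum_eq]
    exact tsum_congr key
  · rw [OrbSummable, OrbSummable, ← E'.summable_iff]
    refine summable_congr fun q => ?_
    rw [key, Function.comp_apply]

/-- The sum over the orbits of a subgroup of finite index. -/
theorem orbSum_of_le (hWV : W ≤ V) (hP : IsStable V P) (h0 : ∀ x, P x → x ≠ 0)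
    (hf : IsOrbInvariant V P f) (hs : OrbSummable V P f) (hfin : W.relIndex V ≠ 0) :
    orbSum W P f = (W.relIndex V : ℂ) * orbSum V P f := by
  have hfW : IsOrbInvariant W P f := fun e he x hx => hf e (hWV he) x hx
  let act : V → {x // P x} → {x // P x} := fun v x => ⟨_, hP v.1 v.2 x.1 x.2⟩
  -- A `V`-orbit with a chosen representative splits into `W`-orbits indexed by the cosets of `W` in
  -- `V`.
  let Φ : Quotient (orbRel V P) × (V ⧸ W.subgroupOf V) → Quotient (orbRel W P) := fun a =>
    Quotient.liftOn' a.2 (fun v => Quotient.mk (orbRel W P) (act v (Quotient.out a.1))) (by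
      intro v v' hv
      rw [QuotientGroup.leftRel_apply, Subgroup.mem_subgroupOf] at hv
      refine Quotient.sound ⟨_, hv, ?_, ?_⟩ <;>
      · simp only [act, Subgroup.coe_mul, Subgroup.coe_inv, Units.val_mul]
        rw [mul_comm (((v.1⁻¹ : Kˣ)) : K), mul_assoc, Units.inv_mul_cancel_left])
  have hΦ : ∀ q (v : V), Φ (q, (v : V ⧸ W.subgroupOf V)) =
      Quotient.mk (orbRel W P) (act v (Quotient.out q)) := fun _ _ => rfl
  have hbij : Function.Bijective Φ := by
    constructor
    · rintro ⟨q, c⟩ ⟨q', c'⟩ h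
      induction c using QuotientGroup.induction_on with | _ v => ?_
      induction c' using QuotientGroup.induction_on with | _ v' => ?_
      rw [hΦ, hΦ] at h
      obtain ⟨e, he, h1, h2⟩ := Quotient.exact h
      simp only [act] at h1 h2
      have hq : q = q' := by
        rw [← Quotient.out_eq q, ← Quotient.out_eq q']
        refine Quotient.sound ⟨v'.1⁻¹ * (e * v.1),
          mul_mem (inv_mem v'.2) (mul_mem (hWV he) v.2), ?_, ?_⟩
        · rw [Units.val_mul, Units.val_mul, mul_assoc, mul_assoc, ← h1, Units.inv_mul_cancel_left]
        · rw [Units.val_mul, Units.val_mul, mul_assoc, mul_assoc, ← h2, Units.inv_mul_cancel_left]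
      subst hq
      -- The action is free: a nonzero pair has a nonzero coordinate that can be cancelled. Thus no
      -- two cosets give the same `W`-orbit.
      have hv : v'.1 = e * v.1 := by
        ext
        rw [Units.val_mul]
        by_cases hx : (Quotient.out q).1.1 = 0
        · have hx' : (Quotient.out q).1.2 ≠ 0 := fun h =>
            h0 _ (Quotient.out q).2 (Prod.ext hx h)
          exact mul_right_cancel₀ hx' (by rw [h2, mul_assoc])
        · exact mul_right_cancel₀ hx (by rw [h1, mul_assoc])
      refine Prod.ext rfl (QuotientGroup.eq.2 ?_)
      rw [Subgroup.mem_subgroupOf]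
      simpa [hv] using he
    · intro q
      induction q using Quotient.inductionOn with | _ x => ?_
      obtain ⟨e, he, h1, h2⟩ := Quotient.mk_out (s := orbRel V P) x
      refine ⟨(Quotient.mk _ x, ((⟨e, he⟩ : V) : V ⧸ W.subgroupOf V)), ?_⟩
      rw [hΦ]
      congr 1
      exact Subtype.ext (Prod.ext h1.symm h2.symm)
  have : (W.subgroupOf V).FiniteIndex := ⟨hfin⟩
  have : Fintype (V ⧸ W.subgroupOf V) := Fintype.ofFinite _
  have hcard : (∑' _ : V ⧸ W.subgroupOf V, (1 : ℂ)) = W.relIndex V := by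
    rw [tsum_fintype, Finset.sum_const, Finset.card_univ, nsmul_eq_mul, mul_one,
      Subgroup.relIndex, Subgroup.index, Nat.card_eq_fintype_card]
  -- As `f` is constant on `V`-orbits, the sum over `W`-orbits is a double series whose inner sum
  -- merely counts cosets.
  rw [mul_comm, orbSum, orbSum, ← hcard, tsum_mul_tsum_of_summable_norm hs (Summable.of_finite),
    ← (Equiv.ofBijective Φ hbij).tsum_eq]
  refine tsum_congr fun ⟨q, c⟩ => ?_
  induction c using QuotientGroup.induction_on with | _ v => ?_
  rw [Equiv.ofBijective_apply, hΦ, hfW.out_mk, mul_one]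
  exact hf v.1 v.2 _ (Quotient.out q).2

/-- Comparison of the sums over the orbits of two commensurable groups. -/
theorem orbSum_commensurable (hPW : IsStable W P) (hPV : IsStable V P) (h0 : ∀ x, P x → x ≠ 0)
    (hfW : IsOrbInvariant W P f) (hfV : IsOrbInvariant V P f)
    (hsW : OrbSummable W P f) (hsV : OrbSummable V P f)
    (hWV : W.relIndex V ≠ 0) (hVW : V.relIndex W ≠ 0) :
    (W.relIndex V : ℂ) * orbSum V P f = (V.relIndex W : ℂ) * orbSum W P f := by
  -- Both sums are compared with the sum over the orbits of the intersection.
  have h1 := orbSum_of_le (W := W ⊓ V) inf_le_right hPV h0 hfV hsV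
    (by rwa [Subgroup.inf_relIndex_right])
  have h2 := orbSum_of_le (W := W ⊓ V) inf_le_left hPW h0 hfW hsW
    (by rwa [Subgroup.inf_relIndex_left])
  rw [Subgroup.inf_relIndex_right] at h1
  rw [Subgroup.inf_relIndex_left] at h2
  rw [← h1, ← h2]

end OrbitSums

/-! ### Invariance of the terms and the transformation formula for the series -/

section Invariance

variable {K : Type*} [Field K] [NumberField K]

/-- The condition defining `ShiftedPairs`. -/
def IsShifted (m n : Submodule ℤ K) (U : Matrix (Fin 2) (Fin 2) K) (x : K × K) : Prop :=
  (x.1 - U 0 1 ∈ m ∧ x.2 - U 1 1 ∈ n) ∧ x ≠ 0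

/-- In this form the group and the index set are independent, which is needed to sum over one set of
pairs modulo two different groups. -/
theorem eisSeries_eq_orbSum (m n : Submodule ℤ K) (U : Matrix (Fin 2) (Fin 2) K)
    (p : (K →+* ℝ) → ℤ) (w : ℤ) (z : (K →+* ℝ) → ℂ) (s : ℂ) :
    eisSeries m n U p w z s =
      orbSum (unitGroupPos m n U) (IsShifted m n U) (eisTerm U p w z s) := rfl

/-- The additive character `x ↦ exp(2πi Tr x)`. -/
noncomputable def expTrace (x : K) : ℂ :=
  Complex.exp (2 * Real.pi * Complex.I * ((Algebra.trace ℚ K x : ℚ) : ℂ))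

theorem expTrace_add (x y : K) : expTrace (x + y) = expTrace x * expTrace y := by
  rw [expTrace, expTrace, expTrace, ← Complex.exp_add, map_add]
  push_cast
  ring_nf

theorem expTrace_eq_one {x : K} (h : ∃ k : ℤ, (k : ℚ) = Algebra.trace ℚ K x) :
    expTrace x = 1 := by
  obtain ⟨k, hk⟩ := h
  rw [expTrace, ← hk, Complex.exp_eq_one_iff]
  exact ⟨k, by push_cast; ring⟩

theorem expTrace_dual {m : Submodule ℤ K} {x y : K} (hx : x ∈ dual m) (hy : y ∈ m) :
    expTrace (x * y) = 1 :=
  expTrace_eq_one (mem_dual.1 hx y hy)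

theorem expTrace_nsmul (N : ℕ) (x : K) : expTrace x ^ N = expTrace ((N : K) * x) := by
  rw [expTrace, expTrace, ← Complex.exp_nat_mul, ← nsmul_eq_mul N x, map_nsmul,
    nsmul_eq_mul]
  push_cast
  ring_nf

theorem one_mem_mult (m : Submodule ℤ K) : (1 : K) ∈ mult m :=
  mem_mult.2 fun y hy => by simpa using hy

/-- Write `u e x = u x + (e - 1) u (x - v) + (e - 1) v u`. The second term has integral trace by the
condition on `u`, the third by the condition on `v u`, as `1` lies in the multiplier ring. -/
theorem expTrace_unitGroup {u v x : K} {m : Submodule ℤ K} {e : Kˣ} (he : e ∈ unitGroup v u m)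
    (hx : x - v ∈ m) : expTrace (u * ((e : K) * x)) = expTrace (u * x) := by
  obtain ⟨-, -, h2, h3⟩ := he
  have h : u * ((e : K) * x) = u * x + ((e : K) - 1) * u * (x - v) +
      ((e : K) - 1) * (v * u) * 1 := by ring
  rw [h, expTrace_add, expTrace_add, expTrace_dual h2 hx, expTrace_dual h3 (one_mem_mult m),
    mul_one, mul_one]

theorem shift_mem_of_unitGroup {u v x : K} {m : Submodule ℤ K} {e : Kˣ}
    (he : e ∈ unitGroup v u m) (hx : x - v ∈ m) : (e : K) * x - v ∈ m := by
  obtain ⟨⟨h0, -⟩, h1, -⟩ := he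
  have h : (e : K) * x - v = (e : K) * (x - v) + ((e : K) - 1) * v := by ring
  rw [h]
  exact add_mem (mem_mult.1 h0 _ hx) h1

theorem isStable_isShifted (m n : Submodule ℤ K) (U : Matrix (Fin 2) (Fin 2) K) :
    IsStable (unitGroupPos m n U) (IsShifted m n U) := by
  rintro e ⟨⟨h1, h2⟩, -⟩ x ⟨⟨hx1, hx2⟩, hx⟩
  refine ⟨⟨shift_mem_of_unitGroup h1 hx1, shift_mem_of_unitGroup h2 hx2⟩, fun h => hx ?_⟩
  simp only [Prod.mk_eq_zero, mul_eq_zero, e.ne_zero, false_or] at h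
  exact Prod.ext h.1 h.2

theorem isOrbInvariant_eisTerm [IsTotallyReal K] (m n : Submodule ℤ K) [Submodule.IsLattice ℚ m]
    (U : Matrix (Fin 2) (Fin 2) K) (p : (K →+* ℝ) → ℤ) (w : ℤ) {z : (K →+* ℝ) → ℂ}
    (hz : z ∈ KCpm K) (s : ℂ) :
    IsOrbInvariant (unitGroupPos m n U) (IsShifted m n U) (eisTerm U p w z s) := by
  intro e he x hx
  have hlog := sum_log_of_mem_unitGroupPos he
  have hpos := pos_of_mem_unitGroupPos he
  obtain ⟨⟨h1, h2⟩, -⟩ := he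
  obtain ⟨⟨hx1, hx2⟩, hx⟩ := hx
  have hexp : expTrace (U 0 0 * ((e : K) * x.1) + U 1 0 * ((e : K) * x.2)) =
      expTrace (U 0 0 * x.1 + U 1 0 * x.2) := by
    rw [expTrace_add, expTrace_add, expTrace_unitGroup h1 hx1, expTrace_unitGroup h2 hx2]
  have hP : monomialP (wtA p w s) (wtB p s)
        (fun σ => ((σ ((e : K) * x.1) : ℝ) : ℂ) * z σ + ((σ ((e : K) * x.2) : ℝ) : ℂ)) =
      monomialP (wtA p w s) (wtB p s)
        (fun σ => ((σ x.1 : ℝ) : ℂ) * z σ + ((σ x.2 : ℝ) : ℂ)) := by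
    have h3 : (fun σ : K →+* ℝ => ((σ ((e : K) * x.1) : ℝ) : ℂ) * z σ +
          ((σ ((e : K) * x.2) : ℝ) : ℂ)) =
        fun σ => ((σ (e : K) : ℝ) : ℂ) * (((σ x.1 : ℝ) : ℂ) * z σ + ((σ x.2 : ℝ) : ℂ)) := by
      funext σ
      simp only [map_mul, Complex.ofReal_mul]
      ring
    rw [h3, monomialP_smul_real (wt_sub p w s) (linear_form_ne_zero hz hx) hpos,
      ← Complex.exp_sum]
    -- The exponents `α + β` all equal `2s + w`, so the unit contributes a power of its norm, which
    -- is one.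
    have h4 : ∑ σ : K →+* ℝ, (wtA p w s σ + wtB p s σ) * ((Real.log (σ (e : K)) : ℝ) : ℂ) =
        (2 * s + w) * ((∑ σ : K →+* ℝ, Real.log (σ (e : K)) : ℝ) : ℂ) := by
      rw [Complex.ofReal_sum, Finset.mul_sum]
      refine Finset.sum_congr rfl fun σ _ => ?_
      simp only [wtA, wtB]
      ring
    rw [h4, hlog, Complex.ofReal_zero, mul_zero, Complex.exp_zero, one_mul]
  simp only [expTrace] at hexp
  simp only [eisTerm, hexp, hP]

theorem isShifted_pairMul {m n m' n' : Submodule ℤ K} {γ : GL (Fin 2) K}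
    (hγ : rowMul (dirSum m n) γ = dirSum m' n') {U : Matrix (Fin 2) (Fin 2) K} {x : K × K}
    (hx : IsShifted m n U x) : IsShifted m' n' (upperAct U γ) (pairMul γ x) := by
  obtain ⟨⟨h1, h2⟩, hx⟩ := hx
  refine ⟨?_, fun h => hx (pairMul_eq_zero.1 h)⟩
  have h : (![x.1 - U 0 1, x.2 - U 1 1] ᵥ* (γ : Matrix (Fin 2) (Fin 2) K)) ∈ dirSum m' n' := by
    rw [← hγ]
    exact mem_rowMul.2 ⟨_, ⟨h1, h2⟩, rfl⟩
  obtain ⟨h3, h4⟩ := h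
  constructor
  · convert h3 using 1
    simp [pairMul, upperAct, Matrix.vecMul, Matrix.mulVec, dotProduct, Fin.sum_univ_two]
    ring
  · convert h4 using 1
    simp [pairMul, upperAct, Matrix.vecMul, Matrix.mulVec, dotProduct, Fin.sum_univ_two]
    ring

theorem rowMul_inv {Λ Λ' : Submodule ℤ (Fin 2 → K)} {γ : GL (Fin 2) K} (h : rowMul Λ γ = Λ') :
    rowMul Λ' γ⁻¹ = Λ := by
  rw [← h, ← rowMul_mul, mul_inv_cancel, rowMul_one]

/-- The bijection of shifted pairs given by a matrix. -/
def shiftedEquiv {m n m' n' : Submodule ℤ K} {γ : GL (Fin 2) K}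
    (hγ : rowMul (dirSum m n) γ = dirSum m' n') (U : Matrix (Fin 2) (Fin 2) K) :
    {x // IsShifted m n U x} ≃ {x // IsShifted m' n' (upperAct U γ) x} where
  toFun x := ⟨pairMul γ x.1, isShifted_pairMul hγ x.2⟩
  invFun x := ⟨pairMul γ⁻¹ x.1, by
    have := isShifted_pairMul (rowMul_inv hγ) x.2
    rwa [← upperAct_mul, mul_inv_cancel, upperAct_one] at this⟩
  left_inv x := Subtype.ext (by
    change pairMul γ⁻¹ (pairMul γ x.1) = x.1
    rw [← pairMul_mul, mul_inv_cancel, pairMul_one])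
  right_inv x := Subtype.ext (by
    change pairMul γ (pairMul γ⁻¹ x.1) = x.1
    rw [← pairMul_mul, inv_mul_cancel, pairMul_one])

theorem pairMul_smul (γ : GL (Fin 2) K) (e : K) (x : K × K) :
    pairMul γ (e * x.1, e * x.2) = (e * (pairMul γ x).1, e * (pairMul γ x).2) := by
  simp only [pairMul, Prod.mk.injEq]
  constructor <;> ring

theorem pairMul_injective (γ : GL (Fin 2) K) : Function.Injective (pairMul γ) := by
  intro x y h
  rw [← pairMul_one x, ← pairMul_one y, ← mul_inv_cancel γ, pairMul_mul, pairMul_mul, h]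

theorem pairMul_scalar_iff (γ : GL (Fin 2) K) (e : K) (x y : K × K) :
    (y.1 = e * x.1 ∧ y.2 = e * x.2) ↔
      ((pairMul γ y).1 = e * (pairMul γ x).1 ∧ (pairMul γ y).2 = e * (pairMul γ x).2) := by
  have h : ∀ a b : K × K, (a.1 = e * b.1 ∧ a.2 = e * b.2) ↔ a = (e * b.1, e * b.2) :=
    fun a b => by rw [Prod.ext_iff]
  rw [h, h, ← pairMul_smul, (pairMul_injective γ).eq_iff]

variable [IsTotallyReal K]

/-- The transformation formula in the domain of absolute convergence. -/
theorem eisSeries_transform {m n m' n' : Submodule ℤ K} [Submodule.IsLattice ℚ m]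
    [Submodule.IsLattice ℚ n] [Submodule.IsLattice ℚ m'] [Submodule.IsLattice ℚ n']
    {γ : GL (Fin 2) K} (hγ : rowMul (dirSum m n) γ = dirSum m' n')
    (U : Matrix (Fin 2) (Fin 2) K) (p : (K →+* ℝ) → ℤ) {w : ℤ} {z : (K →+* ℝ) → ℂ}
    (hz : z ∈ KCpm K) {s : ℂ} (hs : 1 - (w : ℝ) / 2 < s.re) :
    (unitIndex m n U m' n' (upperAct U γ) : ℂ) *
        (eisFactor p w γ z s * eisSeries m n U p w (moeb (toGR K γ) z) s) =
      (unitIndex m' n' (upperAct U γ) m n U : ℂ) * eisSeries m' n' (upperAct U γ) p w z s := by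
  set U' := upperAct U γ with hU'
  set V := unitGroupPos m n U with hV
  set V' := unitGroupPos m' n' U' with hV'
  set P := IsShifted m n U with hP
  -- The terms of the transformed series are pulled back along `γ` to the original index set. There
  -- they are invariant under both unit groups: under `V` by the termwise identity, under `V'` by
  -- transport.
  let f : K × K → ℂ := fun x => eisTerm U' p w z s (pairMul γ x)
  have hf : ∀ x, P x → f x = eisFactor p w γ z s * eisTerm U p w (moeb (toGR K γ) z) s x :=
    fun x hx => (eisFactor_mul_eisTerm U p w γ hz s hx.2).symm
  have hinv' := isOrbInvariant_eisTerm m' n' U' p w hz s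
  have hinv := isOrbInvariant_eisTerm m n U p w (moeb_mem hz γ) s
  have htr := orbSum_transport (W := V') (shiftedEquiv hγ U)
    (fun x y e => pairMul_scalar_iff γ e x.1 y.1) hinv' (f := f) (fun _ => rfl)
  have hstab : IsStable V P := isStable_isShifted m n U
  have hstab' : IsStable V' P := by
    intro e he x hx
    have h1 := isStable_isShifted m' n' U' e he _ (isShifted_pairMul hγ hx)
    rw [← pairMul_smul] at h1
    have h2 := ((shiftedEquiv hγ U).symm ⟨_, h1⟩).2
    change IsShifted m n U (pairMul γ⁻¹ (pairMul γ _)) at h2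
    rwa [← pairMul_mul, mul_inv_cancel, pairMul_one] at h2
  have hfV : IsOrbInvariant V P f := by
    intro e he x hx
    rw [hf _ (hstab e he x hx), hf x hx, hinv e he x hx]
  have hfV' : IsOrbInvariant V' P f := by
    intro e he x hx
    simp only [f, pairMul_smul]
    exact hinv' e he _ (isShifted_pairMul hγ hx)
  have hsV : OrbSummable V P f := by
    have h1 : Summable fun q : Quotient (orbRel V P) =>
        ‖eisTerm U p w (moeb (toGR K γ) z) s (Quotient.out q).1‖ :=
      summable_norm_orbitTerm m n U p hs (moeb_mem hz γ)
    refine (h1.mul_left ‖eisFactor p w γ z s‖).congr fun q => ?_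
    rw [hf _ (Quotient.out q).2, norm_mul]
  have hsV' : OrbSummable V' P f :=
    htr.2.2 (summable_norm_orbitTerm m' n' U' p hs hz)
  have hmain := orbSum_commensurable (W := V') (V := V) hstab' hstab (fun x hx => hx.2) hfV' hfV
    hsV' hsV (unitIndex_pos m n U m' n' U').ne' (unitIndex_pos m' n' U' m n U).ne'
  rw [orbSum_eq_const_mul hf, htr.1] at hmain
  exact hmain

end Invariance

/-! ### Passage to the meromorphic continuation -/

section Continuation

/-- The difference vanishes near `c + 1`, hence has infinite order at every point of the connected
plane. Normal form then fixes the value at each point, poles included. -/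
theorem IsMeroCont.unique {c : ℝ} {F f g : ℂ → ℂ} (hf : IsMeroCont c F f)
    (hg : IsMeroCont c F g) : f = g := by
  have hd : MeromorphicOn (f - g) Set.univ := hf.1.meromorphicOn.sub hg.1.meromorphicOn
  have h0 : meromorphicOrderAt (f - g) ((c + 1 : ℝ) : ℂ) = ⊤ := by
    rw [meromorphicOrderAt_eq_top_iff]
    have hopen : {s : ℂ | c < s.re} ∈ 𝓝 ((c + 1 : ℝ) : ℂ) :=
      (isOpen_lt continuous_const Complex.continuous_re).mem_nhds (by simp)
    filter_upwards [mem_nhdsWithin_of_mem_nhds hopen] with s hs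
    rw [Pi.sub_apply, hf.2 s hs, hg.2 s hs, sub_self]
  funext s
  have h1 : meromorphicOrderAt (f - g) s = ⊤ := by
    by_contra h
    exact hd.meromorphicOrderAt_ne_top_of_isPreconnected isPreconnected_univ (Set.mem_univ s)
      (Set.mem_univ _) h h0
  rw [meromorphicOrderAt_eq_top_iff] at h1
  have h2 : f =ᶠ[𝓝[≠] s] g := h1.mono fun t ht => sub_eq_zero.1 ht
  exact (((hf.1 (Set.mem_univ s)).eventuallyEq_nhdsNE_iff_eventuallyEq_nhds
    (hg.1 (Set.mem_univ s))).1 h2).self_of_nhds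

/-- A zero-free entire factor preserves normal form. -/
theorem IsMeroCont.mul {c : ℝ} {F G f A : ℂ → ℂ} (hf : IsMeroCont c F f)
    (hA : AnalyticOnNhd ℂ A Set.univ) (hA0 : ∀ s, A s ≠ 0)
    (h : ∀ s : ℂ, c < s.re → A s * F s = G s) : IsMeroCont c G (A * f) :=
  ⟨(meromorphicNFOn_mul_iff_right_of_analyticOnNhd hA fun s _ => hA0 s).2 hf.1,
    fun s hs => by rw [Pi.mul_apply, hf.2 s hs, h s hs]⟩

variable {K : Type*} [Field K] [NumberField K]

/-- An identity between two Eisenstein series up to an entire factor without zeros extends from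
the domain of convergence to the continuations. -/
theorem mul_eisG_eq {m n m' n' : Submodule ℤ K} {U U' : Matrix (Fin 2) (Fin 2) K}
    {p : (K →+* ℝ) → ℤ} {w : ℤ} {z z' : (K →+* ℝ) → ℂ} {A : ℂ → ℂ}
    (hA : AnalyticOnNhd ℂ A Set.univ) (hA0 : ∀ s, A s ≠ 0)
    (h : ∀ s : ℂ, 1 - (w : ℝ) / 2 < s.re →
      A s * eisSeries m n U p w z s = eisSeries m' n' U' p w z' s) (s : ℂ) :
    A s * eisG m n U p w s z = eisG m' n' U' p w s z' := by
  by_cases hs : 1 - (w : ℝ) / 2 < s.re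
  · rw [eisG, eisG, if_pos hs, if_pos hs, h s hs]
  rw [eisG, eisG, if_neg hs, if_neg hs]
  have hinv : ∀ s : ℂ, 1 - (w : ℝ) / 2 < s.re →
      A⁻¹ s * eisSeries m' n' U' p w z' s = eisSeries m n U p w z s := fun s hs => by
    rw [← h s hs, Pi.inv_apply, inv_mul_cancel_left₀ (hA0 s)]
  by_cases h1 : ∃ f, IsMeroCont (1 - (w : ℝ) / 2) (eisSeries m n U p w z) f
  · have h3 := h1.choose_spec.mul hA hA0 h
    have h2 : ∃ f, IsMeroCont (1 - (w : ℝ) / 2) (eisSeries m' n' U' p w z') f := ⟨_, h3⟩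
    rw [dif_pos h1, dif_pos h2, ← h3.unique h2.choose_spec, Pi.mul_apply]
  -- Multiplying by the inverse of `A` transfers a continuation back, so the two sides continue or
  -- fail to continue together; in the latter case both take the default value 0.
  · have h2 : ¬ ∃ f, IsMeroCont (1 - (w : ℝ) / 2) (eisSeries m' n' U' p w z') f := by
      rintro ⟨f, hf⟩
      exact h1 ⟨_, hf.mul (hA.inv fun s _ => hA0 s) (fun s => inv_ne_zero (hA0 s)) hinv⟩
    rw [dif_neg h1, dif_neg h2, mul_zero]

variable [IsTotallyReal K]

/-- The transformation formula for all `s`. -/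
theorem eisG_transform {m n m' n' : Submodule ℤ K} [Submodule.IsLattice ℚ m]
    [Submodule.IsLattice ℚ n] [Submodule.IsLattice ℚ m'] [Submodule.IsLattice ℚ n']
    {γ : GL (Fin 2) K} (hγ : rowMul (dirSum m n) γ = dirSum m' n')
    (U : Matrix (Fin 2) (Fin 2) K) (p : (K →+* ℝ) → ℤ) (w : ℤ) {z : (K →+* ℝ) → ℂ}
    (hz : z ∈ KCpm K) (s : ℂ) :
    eisFactor p w γ z s * eisG m n U p w s (moeb (toGR K γ) z) =
      ((unitIndex m' n' (upperAct U γ) m n U : ℂ) /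
        (unitIndex m n U m' n' (upperAct U γ) : ℂ)) * eisG m' n' (upperAct U γ) p w s z := by
  have hf₁ : (unitIndex m n U m' n' (upperAct U γ) : ℂ) ≠ 0 := by
    exact_mod_cast (unitIndex_pos m n U m' n' (upperAct U γ)).ne'
  have hf₂ : (unitIndex m' n' (upperAct U γ) m n U : ℂ) ≠ 0 := by
    exact_mod_cast (unitIndex_pos m' n' (upperAct U γ) m n U).ne'
  set f₁ : ℂ := (unitIndex m n U m' n' (upperAct U γ) : ℂ)
  set f₂ : ℂ := (unitIndex m' n' (upperAct U γ) m n U : ℂ)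
  have h := mul_eisG_eq (m := m) (n := n) (m' := m') (n' := n') (U := U) (U' := upperAct U γ)
    (p := p) (w := w) (z := moeb (toGR K γ) z) (z' := z)
    (A := (fun _ => f₁ / f₂) * eisFactor p w γ z)
    (analyticOnNhd_const.mul (analyticOnNhd_eisFactor p w γ hz))
    (fun s => mul_ne_zero (div_ne_zero hf₁ hf₂) (eisFactor_ne_zero p w γ hz s))
    (fun s hs => by
      rw [Pi.mul_apply, mul_assoc, div_mul_eq_mul_div, div_eq_iff hf₂,
        mul_comm _ f₂]
      exact eisSeries_transform hγ U p hz hs) s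
  rw [← h, Pi.mul_apply]
  field_simp

end Continuation

/-! ### Translation of `U` by the parameter lattice, and modularity -/

section Modularity

variable {K : Type*} [Field K] [NumberField K]

theorem mul_mem_dual_mult {m : Submodule ℤ K} {x y : K} (hx : x ∈ dual m) (hy : y ∈ m) :
    y * x ∈ dual (mult m) := by
  refine mem_dual.2 fun o ho => ?_
  obtain ⟨k, hk⟩ := mem_dual.1 hx _ (mem_mult.1 ho y hy)
  exact ⟨k, by rw [hk]; congr 1; ring⟩

theorem unitGroup_le_of_sub_mem {m : Submodule ℤ K} {u v u' v' : K} (hu : u' - u ∈ dual m)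
    (hv : v' - v ∈ m) : unitGroup v u m ≤ unitGroup v' u' m := by
  rintro e ⟨⟨he, he'⟩, h1, h2, h3⟩
  have hv' : ((e : K) - 1) * (v' - v) ∈ m := by
    rw [_root_.sub_one_mul]
    exact sub_mem (mem_mult.1 he _ hv) hv
  have hu' : ((e : K) - 1) * (u' - u) ∈ dual m := by
    rw [_root_.sub_one_mul]
    exact sub_mem (dual_smul (mem_mult.1 he) hu) hu
  refine ⟨⟨he, he'⟩, ?_, ?_, ?_⟩
  · have := add_mem h1 hv'
    rwa [← mul_add, add_sub_cancel] at this
  · have := add_mem h2 hu'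
    rwa [← mul_add, add_sub_cancel] at this
  -- Expanding `(e - 1) v' u'` about `v u` gives, besides the original term, three cross terms, each
  -- a product of an element of `m` and one of its dual.
  · have := add_mem (add_mem (add_mem h3 (mul_mem_dual_mult hu h1)) (mul_mem_dual_mult h2 hv))
      (mul_mem_dual_mult hu hv')
    convert this using 1
    ring

theorem unitGroupPos_le_of_sub_mem {m n : Submodule ℤ K} {U U' : Matrix (Fin 2) (Fin 2) K}
    (h : U' - U ∈ paramLattice m n) : unitGroupPos m n U ≤ unitGroupPos m n U' := by
  obtain ⟨⟨h1, h2⟩, h3, h4⟩ := h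
  exact inf_le_inf_right _ (inf_le_inf (unitGroup_le_of_sub_mem h1 h3)
    (unitGroup_le_of_sub_mem h2 h4))

theorem unitGroupPos_eq_of_sub_mem {m n : Submodule ℤ K} {U U' : Matrix (Fin 2) (Fin 2) K}
    (h : U' - U ∈ paramLattice m n) : unitGroupPos m n U' = unitGroupPos m n U := by
  refine le_antisymm (unitGroupPos_le_of_sub_mem ?_) (unitGroupPos_le_of_sub_mem h)
  rw [← neg_sub]
  exact neg_mem h

theorem isShifted_eq_of_sub_mem {m n : Submodule ℤ K} {U U' : Matrix (Fin 2) (Fin 2) K}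
    (h : U' - U ∈ paramLattice m n) : IsShifted m n U' = IsShifted m n U := by
  obtain ⟨-, h3, h4⟩ := h
  have key : ∀ {L : Submodule ℤ K} {a v v' : K}, v' - v ∈ L → (a - v' ∈ L ↔ a - v ∈ L) := by
    intro L a v v' h
    rw [← sub_add_sub_cancel a v' v]
    exact (L.add_mem_iff_left h).symm
  funext x
  exact propext (and_congr_left' (and_congr (key h3) (key h4)))

theorem zetaFactor_eq (U U' : Matrix (Fin 2) (Fin 2) K) :
    zetaFactor U U' =
      expTrace (-((U 0 0 - U' 0 0) * U 0 1 + (U 1 0 - U' 1 0) * U 1 1)) := by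
  rw [zetaFactor, expTrace, map_neg]
  push_cast
  ring_nf

theorem zetaFactor_ne_zero (U U' : Matrix (Fin 2) (Fin 2) K) : zetaFactor U U' ≠ 0 :=
  Complex.exp_ne_zero _

/-- The change of `u` pairs integrally with `x - v`, so only its pairing with `v` survives, and this
is independent of `x`. -/
theorem eisTerm_of_sub_mem {m n : Submodule ℤ K} {U U' : Matrix (Fin 2) (Fin 2) K}
    (h : U' - U ∈ paramLattice m n) (p : (K →+* ℝ) → ℤ) (w : ℤ) (z : (K →+* ℝ) → ℂ) (s : ℂ)
    {x : K × K} (hx : IsShifted m n U x) :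
    eisTerm U' p w z s x = zetaFactor U U' * eisTerm U p w z s x := by
  obtain ⟨⟨h1, h2⟩, -⟩ := h
  obtain ⟨⟨h3, h4⟩, -⟩ := hx
  have hexp : expTrace (U' 0 0 * x.1 + U' 1 0 * x.2) =
      zetaFactor U U' * expTrace (U 0 0 * x.1 + U 1 0 * x.2) := by
    have e : U' 0 0 * x.1 + U' 1 0 * x.2 =
        -((U 0 0 - U' 0 0) * U 0 1 + (U 1 0 - U' 1 0) * U 1 1) +
          (U 0 0 * x.1 + U 1 0 * x.2) + (U' - U) 0 0 * (x.1 - U 0 1) +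
          (U' - U) 1 0 * (x.2 - U 1 1) := by
      simp only [Matrix.sub_apply]
      ring
    rw [e, expTrace_add, expTrace_add, expTrace_add, expTrace_dual h1 h3, expTrace_dual h2 h4,
      mul_one, mul_one, zetaFactor_eq]
  simp only [expTrace] at hexp
  simp only [eisTerm, hexp]
  ring

theorem eisSeries_of_sub_mem {m n : Submodule ℤ K} {U U' : Matrix (Fin 2) (Fin 2) K}
    (h : U' - U ∈ paramLattice m n) (p : (K →+* ℝ) → ℤ) (w : ℤ) (z : (K →+* ℝ) → ℂ) (s : ℂ) :
    eisSeries m n U' p w z s = zetaFactor U U' * eisSeries m n U p w z s := by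
  rw [eisSeries_eq_orbSum, eisSeries_eq_orbSum, unitGroupPos_eq_of_sub_mem h,
    isShifted_eq_of_sub_mem h]
  exact orbSum_eq_const_mul fun x hx => eisTerm_of_sub_mem h p w z s hx

theorem eisG_of_sub_mem {m n : Submodule ℤ K} {U U' : Matrix (Fin 2) (Fin 2) K}
    (h : U' - U ∈ paramLattice m n) (p : (K →+* ℝ) → ℤ) (w : ℤ) (s : ℂ) (z : (K →+* ℝ) → ℂ) :
    eisG m n U' p w s z = zetaFactor U U' * eisG m n U p w s z :=
  (mul_eisG_eq (A := fun _ => zetaFactor U U') analyticOnNhd_const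
    (fun _ => zetaFactor_ne_zero U U')
    (fun s _ => (eisSeries_of_sub_mem h p w z s).symm) s).symm

/-- The exponent `N` is absorbed into `v`: `N v` lies in the lattices with whose duals the change of
`u` pairs. -/
theorem zetaFactor_pow_eq_one {m n : Submodule ℤ K} {U U' : Matrix (Fin 2) (Fin 2) K}
    (h : U' - U ∈ paramLattice m n) {N : ℕ} (hN : N • U ∈ paramLattice m n) :
    zetaFactor U U' ^ N = 1 := by
  obtain ⟨⟨h1, h2⟩, -⟩ := h
  obtain ⟨-, h3, h4⟩ := hN
  rw [zetaFactor_eq, expTrace_nsmul]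
  have e : (N : K) * -((U 0 0 - U' 0 0) * U 0 1 + (U 1 0 - U' 1 0) * U 1 1) =
      (U' - U) 0 0 * (N • U) 0 1 + (U' - U) 1 0 * (N • U) 1 1 := by
    simp only [Matrix.sub_apply, Matrix.smul_apply, nsmul_eq_mul]
    ring
  rw [e, expTrace_add, expTrace_dual h1 h3, expTrace_dual h2 h4, mul_one]

/-- Here the factor `N` already sits in the change of `u` and is moved to `v`, so no power is
needed. -/
theorem zetaFactor_eq_one {m n : Submodule ℤ K} {U U' Y : Matrix (Fin 2) (Fin 2) K} {N : ℕ}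
    (hY : Y ∈ paramLattice m n) (h : U' - U = N • Y) (hN : N • U ∈ paramLattice m n) :
    zetaFactor U U' = 1 := by
  obtain ⟨⟨h1, h2⟩, -⟩ := hY
  obtain ⟨-, h3, h4⟩ := hN
  have e0 : ∀ i j, U i j - U' i j = -(N * Y i j) := by
    intro i j
    have := congrFun (congrFun h i) j
    simp only [Matrix.sub_apply, Matrix.smul_apply, nsmul_eq_mul] at this
    rw [← this]
    ring
  have e : -((U 0 0 - U' 0 0) * U 0 1 + (U 1 0 - U' 1 0) * U 1 1) =
      Y 0 0 * (N • U) 0 1 + Y 1 0 * (N • U) 1 1 := by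
    rw [e0, e0]
    simp only [Matrix.smul_apply, nsmul_eq_mul]
    ring
  rw [zetaFactor_eq, e, expTrace_add, expTrace_dual h1 h3, expTrace_dual h2 h4, mul_one]

variable [IsTotallyReal K] {m n : Submodule ℤ K} [Submodule.IsLattice ℚ m]
  [Submodule.IsLattice ℚ n] {U : Matrix (Fin 2) (Fin 2) K}

/-- The unit groups of `U` and `U^γ` coincide, so the quotient of indices is one; what remains of
the transformation formula is the change from `U^γ` back to `U`. -/
theorem slash_eisG {γ : GL (Fin 2) K} (hγ : γ ∈ Gam m n U) (p : (K →+* ℝ) → ℤ) (w : ℤ) (s : ℂ)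
    {z : (K →+* ℝ) → ℂ} (hz : z ∈ KCpm K) :
    slash (fun σ => (w : ℂ) - (p σ : ℂ) / 2) (fun σ => (p σ : ℂ) / 2) (fun _ => s)
        (eisG m n U p w s) (toGR K γ) z =
      zetaFactor U (upperAct U γ) * eisG m n U p w s z := by
  have hi : unitIndex m n (upperAct U γ) m n U = unitIndex m n U m n (upperAct U γ) := by
    rw [unitIndex, unitIndex, unitGroupPos_eq_of_sub_mem hγ.2]
  have h0 : (unitIndex m n U m n (upperAct U γ) : ℂ) ≠ 0 := by
    exact_mod_cast (unitIndex_pos m n U m n (upperAct U γ)).ne'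
  rw [slash, ← eisFactor_eq p w γ hz s, eisG_transform hγ.1 U p w hz s, hi, div_self h0, one_mul,
    eisG_of_sub_mem hγ.2]

end Modularity

end EisGL2

/-! ### Assembly of the three statements -/

theorem mainTheorem9 {K : Type*} [Field K] [NumberField K] [NumberField.IsTotallyReal K]
    (m n : Submodule ℤ K) [Submodule.IsLattice ℚ m] [Submodule.IsLattice ℚ n]
    (U : Matrix (Fin 2) (Fin 2) K) (p : (K →+* ℝ) → ℤ) (w : ℤ) :
    -- the series converges absolutely and defines a continuous function
    (∀ s : ℂ, 1 - (w : ℝ) / 2 < s.re →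
      (∀ z ∈ EisGL2.KCpm K, Summable fun q => ‖EisGL2.orbitTerm m n U p w z s q‖) ∧
      ContinuousOn (EisGL2.eisG m n U p w s) (EisGL2.KCpm K)) ∧
    -- transformation formula for a general matrix
    (∀ (m' n' : Submodule ℤ K) [Submodule.IsLattice ℚ m'] [Submodule.IsLattice ℚ n']
      (γ : GL (Fin 2) K), EisGL2.rowMul (EisGL2.dirSum m n) γ = EisGL2.dirSum m' n' →
      0 < EisGL2.unitIndex m n U m' n' (EisGL2.upperAct U γ) ∧
      0 < EisGL2.unitIndex m' n' (EisGL2.upperAct U γ) m n U ∧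
      ∀ (s : ℂ), ∀ z ∈ EisGL2.KCpm K,
        EisGL2.monomialP (-EisGL2.wtA p w s) (-EisGL2.wtB p s)
            (EisGL2.autJ (EisGL2.toGR K γ) z) *
          EisGL2.absPow (fun σ => ‖EisGL2.autJ (EisGL2.toGR K γ) z σ‖) (fun _ => 2 * s) *
          EisGL2.absPow (EisGL2.detV (EisGL2.toGR K γ)) (fun _ => -s) *
          EisGL2.eisG m n U p w s (EisGL2.moeb (EisGL2.toGR K γ) z) =
        ((EisGL2.unitIndex m' n' (EisGL2.upperAct U γ) m n U : ℂ) /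
            (EisGL2.unitIndex m n U m' n' (EisGL2.upperAct U γ) : ℂ)) *
          EisGL2.eisG m' n' (EisGL2.upperAct U γ) p w s z) ∧
    -- modularity
    (∀ N : ℕ, 1 ≤ N → N • U ∈ EisGL2.paramLattice m n →
      DiscreteTopology ((EisGL2.Gam m n U).map (EisGL2.toGR K)) ∧
      DiscreteTopology ((EisGL2.GamN m n U N).map (EisGL2.toGR K)) ∧
      (∀ γ ∈ EisGL2.Gam m n U,
        EisGL2.zetaFactor U (EisGL2.upperAct U γ) ^ N = 1 ∧
        ∀ (s : ℂ), ∀ z ∈ EisGL2.KCpm K,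
          EisGL2.slash (fun σ => (w : ℂ) - (p σ : ℂ) / 2) (fun σ => (p σ : ℂ) / 2) (fun _ => s)
              (EisGL2.eisG m n U p w s) (EisGL2.toGR K γ) z =
            EisGL2.zetaFactor U (EisGL2.upperAct U γ) * EisGL2.eisG m n U p w s z) ∧
      (∀ s : ℂ,
        EisGL2.IsAlmostOfBiWeight (fun σ => (w : ℂ) - (p σ : ℂ) / 2) (fun σ => (p σ : ℂ) / 2) (fun _ => s)
          ((EisGL2.Gam m n U).map (EisGL2.toGR K)) (EisGL2.eisG m n U p w s) ∧
        EisGL2.IsOfBiWeight (fun σ => (w : ℂ) - (p σ : ℂ) / 2) (fun σ => (p σ : ℂ) / 2) (fun _ => s)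
          ((EisGL2.GamN m n U N).map (EisGL2.toGR K)) (EisGL2.eisG m n U p w s))) := by
  refine ⟨fun s hs => ⟨fun z hz => EisGL2.summable_norm_orbitTerm m n U p hs hz,
    EisGL2.continuousOn_eisG m n U p hs⟩, ?_, ?_⟩
  · intro m' n' _ _ γ hγ
    exact ⟨EisGL2.unitIndex_pos m n U m' n' _, EisGL2.unitIndex_pos m' n' _ m n U,
      fun s z hz => EisGL2.eisG_transform hγ U p w hz s⟩
  · intro N hN hU
    refine ⟨EisGL2.discreteTopology_map_of_le_latticeGL m n fun γ hγ => hγ.1,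
      EisGL2.discreteTopology_map_of_le_latticeGL m n fun γ hγ => hγ.1.1,
      fun γ hγ => ⟨EisGL2.zetaFactor_pow_eq_one hγ.2 hU,
        fun s z hz => EisGL2.slash_eisG hγ p w s hz⟩, fun s => ⟨?_, ?_⟩⟩
    · rintro _ ⟨γ, hγ, rfl⟩
      -- The multiplier is the same on all connected components.
      exact ⟨fun _ => EisGL2.zetaFactor U (EisGL2.upperAct U γ),
        fun _ => ⟨N, hN, EisGL2.zetaFactor_pow_eq_one hγ.2 hU⟩,
        fun z hz => EisGL2.slash_eisG hγ p w s hz⟩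
    · rintro _ ⟨γ, ⟨hγ, Y, hY, h⟩, rfl⟩ z hz
      rw [EisGL2.slash_eisG hγ p w s hz, EisGL2.zetaFactor_eq_one hY h hU, one_mul]
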